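/- Let $\mathcal X=\mathcal X_1\times\cdots\times\mathcal X_n$ and $\mathcal Y=\mathcal Y_1\times\cdots\times\mathcal Y_p$ be products of Euclidean spaces (with the product inner products), let $M=(M_{j,i})_{j\le p,\,i\le n}:\mathcal X\to\mathcal Y$ be linear with blocks $M_{j,i}:\mathcal X_i\to\mathcal Y_j$, and put $I(j)=\{i: M_{j,i}\neq 0\}$, $J(i)=\{j: M_{j,i}\ne 0\}$, $m_j=\mathrm{card}\,I(j)$; assume $m_j\neq0$ for all $j$. Let $f:\mathcal X\to\mathbb R$, $g:\mathcal X\to(-\infty,+\infty]$ and $h:\mathcal Y\to(-\infty,+\infty]$ be closed, proper and convex, let $f$ be differentiable, and let $\beta_i\ge0$ be such that for all $i$, all $x\in\mathcal X$ and all $u\in\mathcal X_i$, $$f(x+U_iu)\le f(x)+\langle\nabla f(x),U_iu\rangle+\tfrac{\beta_i}{2}\|u\|^2,$$ where $U_iu\in\mathcal X$ has $i$-th coordinate $u$ and all other coordinates $0$. Let $h^\star(y)=\sup_{z}\langle y,z\rangle-h(z)$ and let $L(x,y)=f(x)+g(x)+\langle y,Mx\rangle-h^\star(y)$ be the Lagrangian.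 For a tuple $\gamma$ of positive numbers let $D(\gamma)$ denote multiplication of the $l$-th coordinate by $\gamma_l$, and let $\mathrm{prox}_{\gamma,F}(u)=\arg\min_w F(w)+\frac12\sum_l\gamma_l^{-1}\|w^{(l)}-u^{(l)}\|^2$. Let $\sigma_1,\dots,\sigma_p>0$ and $\tau_1,\dots,\tau_n>0$ satisfy, for every $i$, $$\tau_i<\frac1{\beta_i+\rho\big(\sum_{j\in J(i)}m_j\sigma_jM_{j,i}^\star M_{j,i}\big)},$$ where $\rho$ is the spectral radius and the right-hand side is read as $+\infty$ if the denominator vanishes. Let $(i_k)_{k\ge1}$ be independent random variables, uniformly distributed on $\{1,\dots,n\}$. Choose $x_0\in\mathcal X$ and $\boldsymbol y_0=(\boldsymbol y_0^{(j)}(i)\in\mathcal Y_j : 1\le j\le p,\ i\in I(j))$, set $w_0^{(i)}=\sum_{j\in J(i)}M_{j,i}^\star\boldsymbol y_0^{(j)}(i)$ and $z_0^{(j)}=\frac1{m_j}\sum_{i\in I(j)}\boldsymbol y_0^{(j)}(i)$, and for $k\ge0$ let $$\overline y_{k+1}=\mathrm{prox}_{\sigma,h^\star}\big(z_k+D(\sigma)Mx_k\big),\qquad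 \overline x_{k+1}=\mathrm{prox}_{\tau,g}\big(x_k-D(\tau)(\nabla f(x_k)+2M^\star\overline y_{k+1}-w_k)\big);$$ for $i=i_{k+1}$ and each $j\in J(i_{k+1})$ update $$x_{k+1}^{(i)}=\overline x_{k+1}^{(i)},\quad \boldsymbol y_{k+1}^{(j)}(i)=\overline y_{k+1}^{(j)},\quad w_{k+1}^{(i)}=w_k^{(i)}+\sum_{j\in J(i)}M_{j,i}^\star\big(\boldsymbol y_{k+1}^{(j)}(i)-\boldsymbol y_k^{(j)}(i)\big),\quad z_{k+1}^{(j)}=z_k^{(j)}+\tfrac1{m_j}\big(\boldsymbol y_{k+1}^{(j)}(i)-\boldsymbol y_k^{(j)}(i)\big),$$ all other coordinates being kept unchanged. If $L$ has at least one saddle point, then almost surely there exists a (random) saddle point $(x_*,y_*)$ of $L$ such that $x_k\to x_*$ and $\boldsymbol y_k^{(j)}(i)\to y_*^{(j)}$ for every $j\in\{1,\dots,p\}$ and every $i\in I(j)$. -/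

import Mathlib

open Filter Topology MeasureTheory ProbabilityTheory

noncomputable section

namespace CDPrimalDual

/-- A closed proper convex function with values in `(-∞, +∞]` on a Euclidean space:
its epigraph is convex, it is lower semicontinuous, it never takes the value `-∞` and it is
not identically `+∞`. -/
structure IsClosedProperConvex {V : Type*} [NormedAddCommGroup V] [InnerProductSpace ℝ V]
    (F : V → EReal) : Prop where
  ne_bot : ∀ v, F v ≠ ⊥
  exists_ne_top : ∃ v, F v ≠ ⊤
  lsc : LowerSemicontinuous F
  convex_epigraph : Convex ℝ {p : V × ℝ | F p.1 ≤ (p.2 : EReal)}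

/-- The Fenchel-Legendre transform `h⋆ y = sup_z ⟪y, z⟫ - h z`. -/
def conj {V : Type*} [NormedAddCommGroup V] [InnerProductSpace ℝ V]
    (h : V → EReal) (y : V) : EReal :=
  ⨆ z : V, ((inner ℝ y z : ℝ) : EReal) - h z

/-- The gradient of a real function on a Euclidean space. -/
def grad {V : Type*} [NormedAddCommGroup V] [InnerProductSpace ℝ V] [FiniteDimensional ℝ V]
    (f : V → ℝ) (x : V) : V :=
  haveI : CompleteSpace V := FiniteDimensional.complete ℝ V
  gradient f x

section Weighted

variable {l : ℕ} {A : Fin l → Type*} [∀ i, NormedAddCommGroup (A i)]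
  [∀ i, InnerProductSpace ℝ (A i)]

/-- The squared weighted norm `‖u‖²_γ = ∑ i, γ i * ‖u i‖²`. -/
def weightedSq (γ : Fin l → ℝ) (u : PiLp 2 A) : ℝ :=
  ∑ i, γ i * ‖u i‖ ^ 2

/-- The diagonal operator `D(γ)`, multiplying the `i`-th coordinate by `γ i`. -/
def diag (γ : Fin l → ℝ) (u : PiLp 2 A) : PiLp 2 A :=
  WithLp.toLp 2 fun i => γ i • u i

/-- `w` minimizes `w ↦ F w + ½ ‖w - u‖²_{γ⁻¹}`. -/
def IsProx (γ : Fin l → ℝ) (F : PiLp 2 A → EReal) (u w : PiLp 2 A) : Prop :=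
  ∀ v : PiLp 2 A,
    F w + ((1 / 2 * weightedSq (fun i => (γ i)⁻¹) (w - u) : ℝ) : EReal) ≤
      F v + ((1 / 2 * weightedSq (fun i => (γ i)⁻¹) (v - u) : ℝ) : EReal)

/-- The proximity operator `prox_{γ,F}(u) = argmin_w F w + ½ ‖w - u‖²_{γ⁻¹}`: the (unique, when
`F` is closed proper convex and `γ` is positive) minimizer. -/
def prox (γ : Fin l → ℝ) (F : PiLp 2 A → EReal) (u : PiLp 2 A) : PiLp 2 A :=
  Classical.epsilon (IsProx γ F u)

end Weighted

section Algorithm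

variable {n p : ℕ} {E : Fin n → Type*} {F : Fin p → Type*}
  [∀ i, NormedAddCommGroup (E i)] [∀ i, InnerProductSpace ℝ (E i)]
  [∀ j, NormedAddCommGroup (F j)] [∀ j, InnerProductSpace ℝ (F j)]

/-- The block component `M_{j,i}` of the linear operator `M`. -/
def block (M : PiLp 2 E →ₗ[ℝ] PiLp 2 F) (j : Fin p) (i : Fin n) : E i →ₗ[ℝ] F j where
  toFun u := (M (PiLp.single 2 i u)) j
  map_add' u v := by
    have : (PiLp.single 2 i (u + v) : PiLp 2 E) = PiLp.single 2 i u + PiLp.single 2 i v := by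
      simp only [PiLp.single, Pi.single_add, WithLp.toLp_add]
    rw [this, map_add, PiLp.add_apply]
  map_smul' c u := by
    have : (PiLp.single 2 i (c • u) : PiLp 2 E) = c • PiLp.single 2 i u := by
      simp only [PiLp.single, Pi.single_smul, WithLp.toLp_smul]
    rw [this, map_smul, PiLp.smul_apply, RingHom.id_apply]

open Classical in
/-- `I(j) = {i | M_{j,i} ≠ 0}`. -/
def I (M : PiLp 2 E →ₗ[ℝ] PiLp 2 F) (j : Fin p) : Finset (Fin n) :=
  {i | block M j i ≠ 0}

open Classical in
/-- `J(i) = {j | M_{j,i} ≠ 0}`. -/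
def J (M : PiLp 2 E →ₗ[ℝ] PiLp 2 F) (i : Fin n) : Finset (Fin p) :=
  {j | block M j i ≠ 0}

theorem mem_I_of_mem_J {M : PiLp 2 E →ₗ[ℝ] PiLp 2 F} {i : Fin n} {j : Fin p}
    (h : j ∈ J M i) : i ∈ I M j := by
  simpa [I, J] using h

/-- `m_j = card I(j)`. -/
def m (M : PiLp 2 E →ₗ[ℝ] PiLp 2 F) (j : Fin p) : ℕ := (I M j).card

variable [∀ i, FiniteDimensional ℝ (E i)] [∀ j, FiniteDimensional ℝ (F j)]

/-- The spectral radius `ρ(∑_{j ∈ J(i)} m_j σ_j M_{j,i}⋆ M_{j,i})`. The operator is self-adjoint,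
so that its spectrum is real. -/
def stepRadius (M : PiLp 2 E →ₗ[ℝ] PiLp 2 F) (σ : Fin p → ℝ) (i : Fin n) : ℝ :=
  (spectralRadius ℝ
    ((∑ j ∈ J M i, ((m M j : ℝ) * σ j) • ((block M j i).adjoint ∘ₗ block M j i) :
      Module.End ℝ (E i)))).toReal

/-- The Lagrangian `L(x, y) = f x + g x + ⟪y, M x⟫ - h⋆ y`. -/
def lagrangian (f : PiLp 2 E → ℝ) (g : PiLp 2 E → EReal) (h : PiLp 2 F → EReal)
    (M : PiLp 2 E →ₗ[ℝ] PiLp 2 F) (x : PiLp 2 E) (y : PiLp 2 F) : EReal :=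
  (f x : EReal) + g x + ((inner ℝ y (M x) : ℝ) : EReal) - conj h y

/-- The set of saddle points of the Lagrangian. -/
def saddlePoints (f : PiLp 2 E → ℝ) (g : PiLp 2 E → EReal) (h : PiLp 2 F → EReal)
    (M : PiLp 2 E →ₗ[ℝ] PiLp 2 F) : Set (PiLp 2 E × PiLp 2 F) :=
  {z | IsSaddlePointOn Set.univ Set.univ (lagrangian f g h M) z.1 z.2}

/-- The state `(x_k, w_k, z_k, 𝐲_k)` of the algorithm; `yy j i` is the copy `𝐲^{(j)}(i)`,
`i ∈ I(j)`, of the `j`-th dual variable. -/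
structure State (M : PiLp 2 E →ₗ[ℝ] PiLp 2 F) where
  x : PiLp 2 E
  w : PiLp 2 E
  z : PiLp 2 F
  yy : (j : Fin p) → I M j → F j

/-- Initialization of the algorithm at `x₀`, `𝐲₀`. -/
def initState (M : PiLp 2 E →ₗ[ℝ] PiLp 2 F) (x₀ : PiLp 2 E)
    (yy₀ : (j : Fin p) → I M j → F j) : State M where
  x := x₀
  w := WithLp.toLp 2 fun i =>
    ∑ j : J M i, (block M j i).adjoint (yy₀ j ⟨i, mem_I_of_mem_J j.2⟩)
  z := WithLp.toLp 2 fun j => (1 / (m M j : ℝ)) • ∑ i : I M j, yy₀ j i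
  yy := yy₀

/-- `ȳ_{k+1} = prox_{σ,h⋆}(z_k + D(σ) M x_k)`. -/
def yBar (h : PiLp 2 F → EReal) (M : PiLp 2 E →ₗ[ℝ] PiLp 2 F) (σ : Fin p → ℝ)
    (s : State M) : PiLp 2 F :=
  prox σ (conj h) (s.z + diag σ (M s.x))

/-- `x̄_{k+1} = prox_{τ,g}(x_k - D(τ) (∇f(x_k) + 2 M⋆ ȳ_{k+1} - w_k))`. -/
def xBar (f : PiLp 2 E → ℝ) (g : PiLp 2 E → EReal) (h : PiLp 2 F → EReal)
    (M : PiLp 2 E →ₗ[ℝ] PiLp 2 F) (τ : Fin n → ℝ) (σ : Fin p → ℝ) (s : State M) : PiLp 2 E :=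
  prox τ g
    (s.x - diag τ (grad f s.x + (2 : ℝ) • M.adjoint (yBar h M σ s) - s.w))

/-- The new dual copies: `𝐲_{k+1}^{(j)}(i) = ȳ_{k+1}^{(j)}` for the selected `i` and every
`j ∈ J(i)`, the other copies are kept. -/
def nextYY (h : PiLp 2 F → EReal) (M : PiLp 2 E →ₗ[ℝ] PiLp 2 F) (σ : Fin p → ℝ)
    (i : Fin n) (s : State M) : (j : Fin p) → I M j → F j :=
  fun j i' => if (i' : Fin n) = i then yBar h M σ s j else s.yy j i'

/-- One iteration of the algorithm, with selected primal coordinate `i`. -/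
def step (f : PiLp 2 E → ℝ) (g : PiLp 2 E → EReal) (h : PiLp 2 F → EReal)
    (M : PiLp 2 E →ₗ[ℝ] PiLp 2 F) (τ : Fin n → ℝ) (σ : Fin p → ℝ)
    (i : Fin n) (s : State M) : State M where
  x := WithLp.toLp 2 (Function.update (WithLp.ofLp s.x) i (xBar f g h M τ σ s i))
  w := WithLp.toLp 2 (Function.update (WithLp.ofLp s.w) i
    (s.w i + ∑ j : J M i, (block M j i).adjoint
      (nextYY h M σ i s j ⟨i, mem_I_of_mem_J j.2⟩ - s.yy j ⟨i, mem_I_of_mem_J j.2⟩)))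
  z := WithLp.toLp 2 fun j =>
    if hi : i ∈ I M j then
      s.z j + (1 / (m M j : ℝ)) • (nextYY h M σ i s j ⟨i, hi⟩ - s.yy j ⟨i, hi⟩)
    else s.z j
  yy := nextYY h M σ i s

/-- The state after `k` iterations, where `idx k` is the coordinate selected in the iteration
leading from state `k` to state `k + 1`. -/
def iterates (f : PiLp 2 E → ℝ) (g : PiLp 2 E → EReal) (h : PiLp 2 F → EReal)
    (M : PiLp 2 E →ₗ[ℝ] PiLp 2 F) (τ : Fin n → ℝ) (σ : Fin p → ℝ)
    (x₀ : PiLp 2 E) (yy₀ : (j : Fin p) → I M j → F j) (idx : ℕ → Fin n) : ℕ → State M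
  | 0 => initState M x₀ yy₀
  | k + 1 => step f g h M τ σ (idx k) (iterates f g h M τ σ x₀ yy₀ idx k)

end Algorithm

end CDPrimalDual

end

/-!
Almost sure convergence of the randomized coordinate primal-dual algorithm.

Give every dual variable `y j` one copy per index `i ∈ I(j)`. On the duplicated space (`Pair`) the
algorithm is a coordinate version of a deterministic primal-dual step `s ↦ T s` (`fullUpdate`): each
iteration replaces one block of coordinates `(x i, (𝐲 j i) j)` of `s` by that of `T s`. The variables
`w` and `z` are always the aggregates of the copies (`step_pairState`). Duplication makes the metric
`[D(τ)⁻¹, K⋆; K, D(m σ)⁻¹]` (`form`) that governs the full step block diagonal, so that a uniformly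
drawn block update realizes on average `1 / n` of the full step (`sum_form_coordUpdate`).

For a saddle point `t`, add to half the squared distance to `t` in this metric the Bregman divergence
of `f` relative to `t` (`lyapunov`). The variational inequalities of the two proximal steps
(`inner_grad_le_form`), coordinatewise smoothness of `f` and monotonicity of its gradient show that
this function decreases on average by a multiple of `form (s - T s) (s - T s) - ‖x - x̄‖²_β`
(`sum_lyapunov_coordUpdate_le`), and the step size condition makes this quantity dominate
`‖s - T s‖²` (`exists_norm_sq_le_form`).

Convergence of nonnegative supermartingales then gives, almost surely, convergence of the Lyapunov
function along the iterates and `s_k - T s_k → 0` (`ae_tendsto_and_summable_of_sum_le`). The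
exceptional null set depends on `t`, but the Lyapunov function depends on `t` only through an affine
function of `s`, so finitely many saddle points control all of them (`ae_forall_tendsto_sub_apply`).
On the resulting event the iterates are bounded, every cluster point is a saddle point with equal
dual copies (`exists_saddle_of_tendsto`), and Opial's argument (`exists_tendsto_saddle`) yields
convergence.
-/

/-! ### Closed proper convex functions and proximity operators -/

namespace CDPrimalDual

section Convex

variable {V : Type*} [NormedAddCommGroup V] [InnerProductSpace ℝ V]

theorem IsClosedProperConvex.le_lineMap {F : V → EReal} (hF : IsClosedProperConvex F)
    {v w : V} {a b : ℝ} (hv : F v ≤ a) (hw : F w ≤ b) {t : ℝ} (ht0 : 0 ≤ t) (ht1 : t ≤ 1) :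
    F (v + t • (w - v)) ≤ ((a + t * (b - a) : ℝ) : EReal) := by
  have h := hF.convex_epigraph (x := (v, a)) hv (y := (w, b)) hw (a := 1 - t) (b := t)
    (by linarith) ht0 (by ring)
  have h1 : (1 - t) • v + t • w = v + t • (w - v) := by module
  have h2 : (1 - t) * a + t * b = a + t * (b - a) := by ring
  simpa [h1, h2] using h

theorem IsClosedProperConvex.isClosed_epigraph {F : V → EReal} (hF : IsClosedProperConvex F) :
    IsClosed {p : V × ℝ | F p.1 ≤ (p.2 : EReal)} := by
  have h := hF.lsc.isClosed_epigraph
  exact h.preimage (f := fun p : V × ℝ => (p.1, (p.2 : EReal)))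
    (continuous_fst.prodMk (continuous_coe_real_ereal.comp continuous_snd))

theorem IsClosedProperConvex.le_of_tendsto {F : V → EReal} (hF : IsClosedProperConvex F)
    {ι : Type*} {l : Filter ι} [l.NeBot] {u : ι → V} {r : ι → ℝ} {v : V} {a : ℝ}
    (hu : Tendsto u l (𝓝 v)) (hr : Tendsto r l (𝓝 a)) (hle : ∀ i, F (u i) ≤ r i) :
    F v ≤ a :=
  hF.isClosed_epigraph.mem_of_tendsto (hu.prodMk_nhds hr) (Eventually.of_forall hle)

theorem IsClosedProperConvex.exists_real {F : V → EReal} (hF : IsClosedProperConvex F) :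
    ∃ (v : V) (a : ℝ), F v = a := by
  obtain ⟨v, hv⟩ := hF.exists_ne_top
  exact ⟨v, (F v).toReal, (EReal.coe_toReal hv (hF.ne_bot v)).symm⟩

theorem IsClosedProperConvex.exists_real_le {F : V → EReal} (hF : IsClosedProperConvex F)
    {v : V} {r : ℝ} (hr : F v ≤ r) : ∃ a : ℝ, F v = a ∧ a ≤ r := by
  have h := (EReal.coe_toReal (ne_top_of_le_ne_top (EReal.coe_ne_top r) hr) (hF.ne_bot v)).symm
  exact ⟨_, h, by rw [h] at hr; exact_mod_cast hr⟩

/-- A closed proper convex function has an affine minorant: separate its epigraph from a point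
strictly below its graph. -/
theorem IsClosedProperConvex.exists_affine_le [FiniteDimensional ℝ V] {F : V → EReal}
    (hF : IsClosedProperConvex F) :
    ∃ (d : V) (c : ℝ), ∀ v, ((inner ℝ d v + c : ℝ) : EReal) ≤ F v := by
  have : CompleteSpace V := FiniteDimensional.complete ℝ V
  obtain ⟨v₀, a, ha⟩ := hF.exists_real
  have hnot : (v₀, a - 1) ∉ {p : V × ℝ | F p.1 ≤ (p.2 : EReal)} := by
    simp only [Set.mem_ofPred_eq, ha, EReal.coe_le_coe_iff]
    linarith
  obtain ⟨φ, s, hs1, hs2⟩ := geometric_hahn_banach_point_closed hF.convex_epigraph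
    hF.isClosed_epigraph hnot
  have hsplit : ∀ (v : V) (t : ℝ), φ (v, t) = φ (v, 0) + t * φ (0, 1) := by
    intro v t
    have : ((v, t) : V × ℝ) = (v, 0) + t • (0, 1) := by simp
    rw [this, map_add, map_smul, smul_eq_mul]
  set b := φ (0, 1) with hb
  have h0 := hs2 (v₀, a) (by simp [ha])
  rw [hsplit] at hs1 h0
  have hbpos : 0 < b := by nlinarith
  let ψ : V →L[ℝ] ℝ := φ.comp (ContinuousLinearMap.inl ℝ V ℝ)
  refine ⟨(InnerProductSpace.toDual ℝ V).symm (-(b⁻¹ • ψ)), s / b, fun v => ?_⟩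
  rw [InnerProductSpace.toDual_symm_apply]
  induction hv : F v with
  | bot => exact absurd hv (hF.ne_bot v)
  | top => exact le_top
  | coe t =>
    rw [EReal.coe_le_coe_iff]
    have h1 := hs2 (v, t) (by simp [hv])
    rw [hsplit] at h1
    have h2 : ψ v = φ (v, 0) := by simp [ψ]
    simp only [neg_apply, smul_apply, smul_eq_mul, h2]
    have : b * (-(b⁻¹ * φ (v, 0)) + s / b) ≤ b * t := by
      field_simp
      linarith
    exact le_of_mul_le_mul_left this hbpos

theorem le_conj_sub {h : V → EReal} {z : V} {a : ℝ} (ha : h z = a) (y : V) :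
    ((inner ℝ y z - a : ℝ) : EReal) ≤ conj h y := by
  have := le_iSup (fun z : V => ((inner ℝ y z : ℝ) : EReal) - h z) z
  simpa [conj, ha] using this

theorem conj_le_iff {h : V → EReal} (hb : ∀ v, h v ≠ ⊥) {y : V} {r : ℝ} :
    conj h y ≤ r ↔ ∀ (z : V) (a : ℝ), h z = a → inner ℝ y z - a ≤ r := by
  constructor
  · intro H z a ha
    have := (le_conj_sub ha y).trans H
    exact_mod_cast this
  · intro H
    refine iSup_le fun z => ?_
    induction hz : h z with
    | bot => exact absurd hz (hb z)
    | top => simp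
    | coe a => exact_mod_cast H z a hz

/-- The conjugate of a closed proper convex function is closed proper convex; it is proper because
the function has an affine minorant. -/
theorem IsClosedProperConvex.conj [FiniteDimensional ℝ V] {h : V → EReal}
    (hh : IsClosedProperConvex h) : IsClosedProperConvex (CDPrimalDual.conj h) where
  ne_bot y := by
    obtain ⟨v, a, ha⟩ := hh.exists_real
    exact ne_bot_of_le_ne_bot (EReal.coe_ne_bot _) (le_conj_sub ha y)
  exists_ne_top := by
    obtain ⟨d, c, hdc⟩ := hh.exists_affine_le
    refine ⟨d, ne_top_of_le_ne_top (EReal.coe_ne_top (-c)) ((conj_le_iff hh.ne_bot).2 ?_)⟩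
    intro z a hz
    have := hdc z
    rw [hz, EReal.coe_le_coe_iff] at this
    linarith
  lsc := by
    refine lowerSemicontinuous_iSup fun z => Continuous.lowerSemicontinuous ?_
    have hc : Continuous fun y : V => ((inner ℝ y z : ℝ) : EReal) :=
      continuous_coe_real_ereal.comp (by fun_prop)
    induction hz : h z with
    | bot => exact absurd hz (hh.ne_bot z)
    | top => simp only [EReal.sub_top]; exact continuous_const
    | coe a =>
      simp only [← EReal.coe_sub]
      exact continuous_coe_real_ereal.comp (by fun_prop)
  convex_epigraph := by
    rintro ⟨y, r⟩ hy ⟨y', r'⟩ hy' s t hs ht hst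
    simp only [Set.mem_ofPred_eq, Prod.smul_mk, Prod.mk_add_mk, smul_eq_mul] at hy hy' ⊢
    rw [conj_le_iff hh.ne_bot] at hy hy' ⊢
    intro z a hz
    have h1 := hy z a hz
    have h2 := hy' z a hz
    rw [inner_add_left, real_inner_smul_left, real_inner_smul_left]
    have : a = s * a + t * a := by rw [← add_mul, hst, one_mul]
    nlinarith

/-- First-order optimality condition for `F + φ` with `F` convex and `φ` differentiable
along segments. -/
theorem IsClosedProperConvex.le_of_isMin {F : V → EReal} (hF : IsClosedProperConvex F)
    {φ : V → ℝ} {w : V} {a : ℝ} (ha : F w = a)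
    (hmin : ∀ (v : V) (r : ℝ), F v ≤ r → a + φ w ≤ r + φ v)
    {v : V} {D : ℝ} (hD : HasDerivAt (fun t : ℝ => φ (w + t • (v - w))) D 0)
    {r : ℝ} (hr : F v ≤ r) : a ≤ r + D := by
  have hs := hD.hasDerivWithinAt (s := Set.Ioi 0)
  rw [hasDerivWithinAt_iff_tendsto_slope' (by simp)] at hs
  have : a - r ≤ D := by
    refine ge_of_tendsto hs ?_
    have : Set.Ioo (0 : ℝ) 1 ∈ 𝓝[>] (0 : ℝ) := Ioo_mem_nhdsGT one_pos
    filter_upwards [this] with t ht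
    have h1 := hmin _ _ (hF.le_lineMap ha.le hr ht.1.le ht.2.le)
    rw [slope_def_field, zero_smul, add_zero, sub_zero, le_div_iff₀ ht.1]
    nlinarith
  linarith

end Convex

section Prox

variable {l : ℕ} {A : Fin l → Type*} [∀ i, NormedAddCommGroup (A i)]
theorem exists_pos_mul_le_weightedSq_inv {γ : Fin l → ℝ} (hγ : ∀ i, 0 < γ i) :
    ∃ κ > 0, ∀ u : PiLp 2 A, κ * ‖u‖ ^ 2 ≤ weightedSq (fun i => (γ i)⁻¹) u := by
  refine ⟨(1 + ∑ i, γ i)⁻¹, ?_, fun u => ?_⟩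
  · have := Finset.sum_nonneg (s := Finset.univ) (fun i _ => (hγ i).le)
    positivity
  · rw [PiLp.norm_sq_eq_of_L2, Finset.mul_sum]
    refine Finset.sum_le_sum fun i _ => mul_le_mul_of_nonneg_right ?_ (sq_nonneg _)
    refine inv_anti₀ (hγ i) ?_
    have := Finset.single_le_sum (f := γ) (fun i _ => (hγ i).le) (Finset.mem_univ i)
    linarith

theorem continuous_weightedSq (γ : Fin l → ℝ) : Continuous (weightedSq γ : PiLp 2 A → ℝ) := by
  unfold weightedSq
  fun_prop

variable [∀ i, InnerProductSpace ℝ (A i)]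

theorem diag_apply (γ : Fin l → ℝ) (u : PiLp 2 A) (i : Fin l) : diag γ u i = γ i • u i := rfl

theorem diag_inv_sub {γ : Fin l → ℝ} (hγ : ∀ i, 0 < γ i) (a b c : PiLp 2 A) :
    diag (fun i => (γ i)⁻¹) (a - diag γ b - c) = diag (fun i => (γ i)⁻¹) (a - c) - b := by
  ext i
  simp only [diag_apply, PiLp.sub_apply, smul_sub, smul_smul, inv_mul_cancel₀ (hγ i).ne', one_smul]
  abel

theorem diag_inv_add {γ : Fin l → ℝ} (hγ : ∀ i, 0 < γ i) (a b c : PiLp 2 A) :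
    diag (fun i => (γ i)⁻¹) (a + diag γ b - c) = diag (fun i => (γ i)⁻¹) (a - c) + b := by
  ext i
  simp only [diag_apply, PiLp.sub_apply, PiLp.add_apply, smul_sub, smul_add, smul_smul,
    inv_mul_cancel₀ (hγ i).ne', one_smul]
  abel

/-- The proximity operator of a closed proper convex function is everywhere defined: the affine
minorant makes the prox objective coercive. -/
theorem IsClosedProperConvex.exists_isProx [∀ i, FiniteDimensional ℝ (A i)]
    {F : PiLp 2 A → EReal} (hF : IsClosedProperConvex F) {γ : Fin l → ℝ} (hγ : ∀ i, 0 < γ i)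
    (u : PiLp 2 A) : ∃ w, IsProx γ F u w := by
  have : FiniteDimensional ℝ (PiLp 2 A) := inferInstance
  have : ProperSpace (PiLp 2 A) := FiniteDimensional.proper_real _
  obtain ⟨v₀, b, hb⟩ := hF.exists_real
  obtain ⟨d, c, hdc⟩ := hF.exists_affine_le
  obtain ⟨κ, hκ, hκle⟩ := exists_pos_mul_le_weightedSq_inv (A := A) hγ
  set q : PiLp 2 A → ℝ := fun v => 1 / 2 * weightedSq (fun i => (γ i)⁻¹) (v - u) with hq
  have hqc : Continuous q := by
    have := continuous_weightedSq (A := A) (fun i => (γ i)⁻¹)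
    fun_prop
  have hlsc : LowerSemicontinuous fun v => F v + (q v : EReal) := by
    refine hF.lsc.add' (continuous_coe_real_ereal.comp hqc).lowerSemicontinuous fun v => ?_
    exact EReal.continuousAt_add (Or.inr (EReal.coe_ne_bot _)) (Or.inr (EReal.coe_ne_top _))
  -- outside the ball of radius `R` around `u` the objective exceeds its value at `v₀`
  set C : ℝ := |b + q v₀ - c - inner ℝ d u| with hC
  set R : ℝ := max ‖v₀ - u‖ ((2 * ‖d‖ + 2) / κ + C + 1) with hR
  obtain ⟨w, hwK, hw⟩ := LowerSemicontinuousOn.exists_isMinOn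
    (s := Metric.closedBall u R) ⟨v₀, by simp [hR, dist_eq_norm]⟩
    (isCompact_closedBall u R) (hlsc.lowerSemicontinuousOn _)
  refine ⟨w, fun v => ?_⟩
  change F w + (q w : EReal) ≤ F v + (q v : EReal)
  by_cases hv : v ∈ Metric.closedBall u R
  · exact hw hv
  · have h0 : F w + (q w : EReal) ≤ F v₀ + (q v₀ : EReal) :=
      hw (by simp [hR, dist_eq_norm])
    refine h0.trans ?_
    rw [hb]
    refine le_trans ?_ (add_le_add_left (hdc v) _)
    rw [← EReal.coe_add, ← EReal.coe_add, EReal.coe_le_coe_iff]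
    rw [Metric.mem_closedBall, not_le, dist_eq_norm] at hv
    have h1 := hκle (v - u)
    have h2 : inner ℝ d v = inner ℝ d u + inner ℝ d (v - u) := by rw [inner_sub_right]; ring
    have h3 := (abs_le.1 (abs_real_inner_le_norm d (v - u))).1
    have h4 : (2 * ‖d‖ + 2) / κ + C + 1 < ‖v - u‖ := lt_of_le_of_lt (le_max_right _ _) hv
    have hC0 : 0 ≤ C := abs_nonneg _
    have h5 : b + q v₀ - c - inner ℝ d u ≤ C := le_abs_self _
    have h6 : 2 * ‖d‖ + 2 ≤ κ * ‖v - u‖ := by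
      have : (2 * ‖d‖ + 2) / κ ≤ ‖v - u‖ := by linarith
      rwa [div_le_iff₀' hκ] at this
    have h7 : (2 * ‖d‖ + 2) * ‖v - u‖ ≤ κ * ‖v - u‖ ^ 2 := by
      rw [sq, ← mul_assoc]
      exact mul_le_mul_of_nonneg_right h6 (norm_nonneg _)
    have h8 : C ≤ ‖v - u‖ := by
      have : 0 ≤ (2 * ‖d‖ + 2) / κ := by positivity
      linarith
    have h9 : q v = 1 / 2 * weightedSq (fun i => (γ i)⁻¹) (v - u) := rfl
    rw [h9, h2]
    linarith

theorem IsClosedProperConvex.isProx_prox [∀ i, FiniteDimensional ℝ (A i)]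
    {F : PiLp 2 A → EReal} (hF : IsClosedProperConvex F) {γ : Fin l → ℝ} (hγ : ∀ i, 0 < γ i)
    (u : PiLp 2 A) : IsProx γ F u (prox γ F u) :=
  Classical.epsilon_spec (hF.exists_isProx hγ u)

/-- The value of `F` at a proximal point is finite, and the point satisfies the variational
inequality `F w + ⟪D(γ)⁻¹ (u - w), v - w⟫ ≤ F v`. -/
theorem IsClosedProperConvex.le_of_isProx {F : PiLp 2 A → EReal} (hF : IsClosedProperConvex F)
    {γ : Fin l → ℝ} {u w : PiLp 2 A} (hw : IsProx γ F u w) :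
    ∃ a : ℝ, F w = a ∧ ∀ (v : PiLp 2 A) (r : ℝ), F v ≤ r →
      a + inner ℝ (diag (fun i => (γ i)⁻¹) (u - w)) (v - w) ≤ r := by
  set q : PiLp 2 A → ℝ := fun v => 1 / 2 * weightedSq (fun i => (γ i)⁻¹) (v - u) with hq
  obtain ⟨v₀, b, hb⟩ := hF.exists_real
  have hwt : F w ≠ ⊤ := by
    intro htop
    have := hw v₀
    rw [htop, hb, EReal.top_add_coe, ← EReal.coe_add] at this
    exact EReal.coe_ne_top _ (top_le_iff.1 this)
  have ha := (EReal.coe_toReal hwt (hF.ne_bot w)).symm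
  set a := (F w).toReal
  refine ⟨a, ha, fun v r hr => ?_⟩
  have hmin : ∀ (v : PiLp 2 A) (r : ℝ), F v ≤ r → a + q w ≤ r + q v := by
    intro v r hr
    have h1 := (hw v).trans (add_le_add_left hr _)
    rw [ha] at h1
    exact_mod_cast h1
  have hpoly : ∀ t : ℝ, q (w + t • (v - w)) =
      q w + t * -inner ℝ (diag (fun i => (γ i)⁻¹) (u - w)) (v - w) + t ^ 2 *
        (1 / 2 * weightedSq (fun i => (γ i)⁻¹) (v - w)) := by
    intro t
    simp only [hq, weightedSq, PiLp.inner_apply, diag_apply, Finset.mul_sum,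
      ← Finset.sum_neg_distrib, ← Finset.sum_add_distrib]
    refine Finset.sum_congr rfl fun i _ => ?_
    have : (w + t • (v - w) - u) i = (w - u) i + t • (v - w) i := by
      simp only [PiLp.sub_apply, PiLp.add_apply, PiLp.smul_apply]; abel
    have h2 : (u - w) i = - (w - u) i := by simp
    rw [this, norm_add_sq_real, norm_smul, real_inner_smul_right, real_inner_smul_left, h2,
      inner_neg_left, mul_pow, Real.norm_eq_abs, sq_abs]
    ring
  have hD : HasDerivAt (fun t : ℝ => q (w + t • (v - w)))
      (-inner ℝ (diag (fun i => (γ i)⁻¹) (u - w)) (v - w)) 0 := by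
    simp only [hpoly]
    have h1 := (((hasDerivAt_id (0 : ℝ)).mul_const
      (-inner ℝ (diag (fun i => (γ i)⁻¹) (u - w)) (v - w))).const_add (q w)).add
      (((hasDerivAt_id (0 : ℝ)).pow 2).mul_const
        (1 / 2 * weightedSq (fun i => (γ i)⁻¹) (v - w)))
    refine h1.congr_deriv ?_
    simp
  have := hF.le_of_isMin ha hmin hD hr
  linarith

end Prox

end CDPrimalDual

/-! ### Gradients, saddle points and blocks of the linear operator -/

namespace CDPrimalDual

section Gradient

variable {V : Type*} [NormedAddCommGroup V] [InnerProductSpace ℝ V] [FiniteDimensional ℝ V]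

theorem hasDerivAt_grad {f : V → ℝ} (hf : Differentiable ℝ f) (x u : V) :
    HasDerivAt (fun t : ℝ => f (x + t • u)) (inner ℝ (grad f x) u) 0 := by
  have : CompleteSpace V := FiniteDimensional.complete ℝ V
  have h1 : HasFDerivAt f (InnerProductSpace.toDual ℝ V (grad f x)) (x + (0 : ℝ) • u) := by
    rw [zero_smul, add_zero]
    exact (hf x).hasGradientAt.hasFDerivAt
  have h2 : HasDerivAt (fun t : ℝ => x + t • u) u 0 := by
    simpa using ((hasDerivAt_id (0 : ℝ)).smul_const u).const_add x
  have h3 := h1.comp_hasDerivAt (0 : ℝ) h2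
  rwa [InnerProductSpace.toDual_apply_apply] at h3

theorem add_inner_grad_le {f : V → ℝ} (hc : ConvexOn ℝ Set.univ f) (hf : Differentiable ℝ f)
    (x v : V) : f x + inner ℝ (grad f x) (v - x) ≤ f v := by
  have hs := (hasDerivAt_grad hf x (v - x)).hasDerivWithinAt (s := Set.Ioi 0)
  rw [hasDerivWithinAt_iff_tendsto_slope' (by simp)] at hs
  have : inner ℝ (grad f x) (v - x) ≤ f v - f x := by
    refine le_of_tendsto hs ?_
    have : Set.Ioo (0 : ℝ) 1 ∈ 𝓝[>] (0 : ℝ) := Ioo_mem_nhdsGT one_pos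
    filter_upwards [this] with t ht
    rw [slope_def_field, zero_smul, add_zero, sub_zero, div_le_iff₀ ht.1]
    have h1 := hc.2 (Set.mem_univ x) (Set.mem_univ v) (sub_nonneg.2 ht.2.le) ht.1.le
      (sub_add_cancel 1 t)
    have h2 : (1 - t) • x + t • v = x + t • (v - x) := by module
    rw [h2, smul_eq_mul, smul_eq_mul] at h1
    linarith
  linarith

/-- The gradient of a convex function is monotone. -/
theorem inner_grad_sub_nonneg {f : V → ℝ} (hc : ConvexOn ℝ Set.univ f) (hf : Differentiable ℝ f)
    (x v : V) : 0 ≤ inner ℝ (grad f x - grad f v) (x - v) := by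
  have h1 := add_inner_grad_le hc hf x v
  have h2 := add_inner_grad_le hc hf v x
  rw [inner_sub_left]
  rw [← neg_sub x v, inner_neg_right] at h1
  linarith

end Gradient

section Saddle

variable {n p : ℕ} {E : Fin n → Type*} {F : Fin p → Type*}
  [∀ i, NormedAddCommGroup (E i)] [∀ i, InnerProductSpace ℝ (E i)]
  [∀ j, NormedAddCommGroup (F j)] [∀ j, InnerProductSpace ℝ (F j)]
  {f : PiLp 2 E → ℝ} {g : PiLp 2 E → EReal} {h : PiLp 2 F → EReal}
  {M : PiLp 2 E →ₗ[ℝ] PiLp 2 F}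

theorem lagrangian_coe {x : PiLp 2 E} {y : PiLp 2 F} {a b : ℝ} (ha : g x = a)
    (hb : conj h y = b) :
    lagrangian f g h M x y = ((f x + a + inner ℝ y (M x) - b : ℝ) : EReal) := by
  simp [lagrangian, ha, hb]

/-- Saddle points in terms of finite values: the primal component minimizes `L(·, y)` and the
dual component maximizes `L(x, ·)`. The convention `⊤ - ⊤ = ⊥` is harmless here because `h⋆` is
proper. -/
theorem mem_saddlePoints_iff [∀ j, FiniteDimensional ℝ (F j)]
    (hg : IsClosedProperConvex g) (hh : IsClosedProperConvex h)
    {x : PiLp 2 E} {y : PiLp 2 F} :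
    (x, y) ∈ saddlePoints f g h M ↔ ∃ a b : ℝ, g x = a ∧ conj h y = b ∧
      (∀ (v : PiLp 2 E) (r : ℝ), g v ≤ r →
        a + (f x + inner ℝ y (M x)) ≤ r + (f v + inner ℝ y (M v))) ∧
      ∀ (z : PiLp 2 F) (r : ℝ), conj h z ≤ r → b + inner ℝ (M x) (z - y) ≤ r := by
  have hc := hh.conj
  constructor
  · intro hS
    have hS : ∀ v z, lagrangian f g h M x z ≤ lagrangian f g h M v y :=
      fun v z => hS v trivial z trivial
    have hytop : conj h y ≠ ⊤ := by
      intro htop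
      obtain ⟨z, c, hz⟩ := hc.exists_real
      have h1 := hS x z
      rw [lagrangian, lagrangian, htop, EReal.sub_top, le_bot_iff, hz, sub_eq_add_neg,
        EReal.add_eq_bot_iff, EReal.add_eq_bot_iff, EReal.add_eq_bot_iff] at h1
      rcases h1 with ((h1 | h1) | h1) | h1
      · exact EReal.coe_ne_bot _ h1
      · exact hg.ne_bot x h1
      · exact EReal.coe_ne_bot _ h1
      · rw [← EReal.coe_neg] at h1; exact EReal.coe_ne_bot _ h1
    have hb := (EReal.coe_toReal hytop (hc.ne_bot y)).symm
    have hxtop : g x ≠ ⊤ := by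
      intro htop
      obtain ⟨v, c, hv⟩ := hg.exists_real
      have h1 := hS v y
      rw [lagrangian_coe hv hb, lagrangian, htop, hb, EReal.coe_add_top, EReal.top_add_coe,
        EReal.top_sub_coe, top_le_iff] at h1
      exact EReal.coe_ne_top _ h1
    have ha := (EReal.coe_toReal hxtop (hg.ne_bot x)).symm
    refine ⟨_, _, ha, hb, fun v r hr => ?_, fun z r hr => ?_⟩
    · obtain ⟨s, hs, hsr⟩ := hg.exists_real_le hr
      have h1 := hS v y
      rw [lagrangian_coe ha hb, lagrangian_coe hs hb, EReal.coe_le_coe_iff] at h1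
      linarith
    · obtain ⟨s, hs, hsr⟩ := hc.exists_real_le hr
      have h1 := hS x z
      rw [lagrangian_coe ha hb, lagrangian_coe ha hs, EReal.coe_le_coe_iff] at h1
      rw [inner_sub_right, real_inner_comm z, real_inner_comm y]
      linarith
  · rintro ⟨a, b, ha, hb, hx, hy⟩ v _ z _
    have h1 : lagrangian f g h M x z ≤ ((f x + a + inner ℝ y (M x) - b : ℝ) : EReal) := by
      by_cases hz : conj h z = ⊤
      · rw [lagrangian, hz, EReal.sub_top]; exact bot_le
      · have hz := (EReal.coe_toReal hz (hc.ne_bot z)).symm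
        rw [lagrangian_coe ha hz, EReal.coe_le_coe_iff]
        have := hy z _ hz.le
        rw [inner_sub_right, real_inner_comm z, real_inner_comm y] at this
        linarith
    have h2 : ((f x + a + inner ℝ y (M x) - b : ℝ) : EReal) ≤ lagrangian f g h M v y := by
      by_cases hv : g v = ⊤
      · rw [lagrangian, hv, hb, EReal.coe_add_top, EReal.top_add_coe, EReal.top_sub_coe]
        exact le_top
      · have hv := (EReal.coe_toReal hv (hg.ne_bot v)).symm
        rw [lagrangian_coe hv hb, EReal.coe_le_coe_iff]
        have := hx v _ hv.le
        linarith
    exact h1.trans h2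

/-- The primal optimality condition `-∇f(x) - M⋆ y ∈ ∂g(x)` at a saddle point. -/
theorem primal_optimality [∀ i, FiniteDimensional ℝ (E i)]
    (hf' : Differentiable ℝ f) (hg : IsClosedProperConvex g)
    {x : PiLp 2 E} {y : PiLp 2 F} {a : ℝ} (ha : g x = a)
    (hmin : ∀ (v : PiLp 2 E) (r : ℝ), g v ≤ r →
        a + (f x + inner ℝ y (M x)) ≤ r + (f v + inner ℝ y (M v)))
    {v : PiLp 2 E} {r : ℝ} (hr : g v ≤ r) :
    a ≤ r + (inner ℝ (grad f x) (v - x) + inner ℝ y (M (v - x))) := by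
  refine hg.le_of_isMin (φ := fun v => f v + inner ℝ y (M v)) ha hmin ?_ hr
  refine (hasDerivAt_grad hf' x (v - x)).add ?_
  simp only [map_add, map_smul, inner_add_right, real_inner_smul_right]
  simpa using ((hasDerivAt_id (0 : ℝ)).mul_const (inner ℝ y (M (v - x)))).const_add
    (inner ℝ y (M x))

end Saddle

section Blocks

theorem sum_single {n : ℕ} {E : Fin n → Type*} [∀ i, NormedAddCommGroup (E i)] (u : PiLp 2 E) :
    ∑ i, PiLp.single 2 i (u i) = u := by
  ext l
  simp [WithLp.ofLp_sum, Finset.sum_apply, Finset.sum_pi_single]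


variable {n p : ℕ} {E : Fin n → Type*} {F : Fin p → Type*}
  [∀ i, NormedAddCommGroup (E i)] [∀ i, InnerProductSpace ℝ (E i)]
  [∀ j, NormedAddCommGroup (F j)] [∀ j, InnerProductSpace ℝ (F j)]

theorem map_apply_eq_sum_block (M : PiLp 2 E →ₗ[ℝ] PiLp 2 F) (x : PiLp 2 E) (j : Fin p) :
    M x j = ∑ i : I M j, block M j i (x i) := by
  classical
  rw [Finset.sum_coe_sort (I M j) fun i => block M j i (x i),
    Finset.sum_subset (Finset.subset_univ _)]
  · conv_lhs => rw [← sum_single x, map_sum, WithLp.ofLp_sum, Finset.sum_apply]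
    rfl
  · intro i _ hi
    have : block M j i = 0 := by simpa [I] using hi
    simp [this]

theorem inner_map_eq_sum_block (M : PiLp 2 E →ₗ[ℝ] PiLp 2 F) (x : PiLp 2 E) (y : PiLp 2 F) :
    inner ℝ y (M x) = ∑ j, ∑ i : I M j, inner ℝ (y j) (block M j i (x i)) := by
  rw [PiLp.inner_apply]
  refine Finset.sum_congr rfl fun j _ => ?_
  rw [map_apply_eq_sum_block, inner_sum]

theorem mem_J_of_mem_I {M : PiLp 2 E →ₗ[ℝ] PiLp 2 F} {i : Fin n} {j : Fin p}
    (h : i ∈ I M j) : j ∈ J M i := by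
  simpa [I, J] using h

/-- Summation over the pairs `(j, i)` with `M_{j,i} ≠ 0`, in either order. -/
theorem sum_I_eq_sum_J (M : PiLp 2 E →ₗ[ℝ] PiLp 2 F) (a : (j : Fin p) → I M j → ℝ) :
    ∑ j, ∑ i : I M j, a j i = ∑ i, ∑ j : J M i, a j ⟨i, mem_I_of_mem_J j.2⟩ := by
  rw [← Fintype.sum_sigma (fun q : (j : Fin p) × I M j => a q.1 q.2),
    ← Fintype.sum_sigma (fun q : (i : Fin n) × J M i => a q.2 ⟨q.1, mem_I_of_mem_J q.2.2⟩)]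
  exact Fintype.sum_equiv
    { toFun := fun q => ⟨q.2, q.1, mem_J_of_mem_I q.2.2⟩
      invFun := fun q => ⟨q.2, q.1, mem_I_of_mem_J q.2.2⟩
      left_inv := fun _ => rfl
      right_inv := fun _ => rfl } _ _ fun _ => rfl

end Blocks

end CDPrimalDual

/-! ### The block diagonal metric on the duplicated space -/

namespace CDPrimalDual

section SpectralRadius

variable {V : Type*} [NormedAddCommGroup V] [InnerProductSpace ℝ V] [FiniteDimensional ℝ V]

/-- A symmetric operator is bounded above by its (real) spectral radius. -/
theorem inner_le_spectralRadius_mul {T : Module.End ℝ V} (hT : LinearMap.IsSymmetric T) (v : V) :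
    inner ℝ (T v) v ≤ (spectralRadius ℝ T).toReal * ‖v‖ ^ 2 := by
  have hfin : spectralRadius ℝ T ≠ ⊤ := by
    have hf : (spectrum ℝ T).Finite := Module.End.finite_spectrum T
    unfold spectralRadius
    rw [← Set.Finite.coe_toFinset hf]
    refine ne_of_lt ?_
    simp only [Finset.mem_coe]
    rw [← Finset.sup_eq_iSup, Finset.sup_lt_iff (by simp)]
    intro k _
    simp
  have hev : ∀ i, hT.eigenvalues rfl i ≤ (spectralRadius ℝ T).toReal := by
    intro i
    have h1 := (hT.hasEigenvalue_eigenvalues rfl i).mem_spectrum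
    have h2 : (‖hT.eigenvalues rfl i‖₊ : ENNReal) ≤ spectralRadius ℝ T :=
      le_iSup₂ (f := fun k (_ : k ∈ spectrum ℝ T) => (‖k‖₊ : ENNReal)) _ h1
    have h3 := ENNReal.toReal_mono hfin h2
    exact (le_abs_self _).trans (by simpa using h3)
  set b := hT.eigenvectorBasis rfl
  rw [← b.sum_inner_mul_inner, ← b.sum_sq_norm_inner_right v, Finset.mul_sum]
  refine Finset.sum_le_sum fun i _ => ?_
  have h1 : inner ℝ (T v) (b i) = hT.eigenvalues rfl i * inner ℝ (b i) v := by
    rw [hT v (b i), hT.apply_eigenvectorBasis rfl i, real_inner_comm]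
    simp [inner_smul_left, b]
  rw [h1, Real.norm_eq_abs, sq_abs, sq, mul_assoc]
  exact mul_le_mul_of_nonneg_right (hev i) (mul_self_nonneg _)

end SpectralRadius

section Form

variable {n p : ℕ} {E : Fin n → Type*} {F : Fin p → Type*}
  [∀ i, NormedAddCommGroup (E i)] [∀ i, InnerProductSpace ℝ (E i)]
  [∀ j, NormedAddCommGroup (F j)] [∀ j, InnerProductSpace ℝ (F j)]

/-- The space of primal variables together with the duplicated dual variables. -/
abbrev Pair (M : PiLp 2 E →ₗ[ℝ] PiLp 2 F) : Type _ :=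
  PiLp 2 E × ((j : Fin p) → I M j → F j)

/-- All copies of the `j`-th dual variable equal to `y j`. -/
def dup (M : PiLp 2 E →ₗ[ℝ] PiLp 2 F) (y : PiLp 2 F) : (j : Fin p) → I M j → F j :=
  fun j _ => y j

/-- The bilinear form associated with the `i`-th diagonal block
`[τ_i⁻¹, M_{·,i}⋆; M_{·,i}, D(m σ)⁻¹]` of the metric, acting on the primal coordinate `i` and on
the copies `𝐲^{(j)}(i)`, `j ∈ J(i)`. -/
noncomputable def blockForm (M : PiLp 2 E →ₗ[ℝ] PiLp 2 F) (τ : Fin n → ℝ) (σ : Fin p → ℝ) (i : Fin n) :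
    Pair M →ₗ[ℝ] Pair M →ₗ[ℝ] ℝ :=
  LinearMap.mk₂ ℝ
    (fun s t => (τ i)⁻¹ * inner ℝ (s.1 i) (t.1 i) + ∑ j : J M i,
      (inner ℝ (s.2 j ⟨i, mem_I_of_mem_J j.2⟩) (block M j i (t.1 i)) +
        inner ℝ (t.2 j ⟨i, mem_I_of_mem_J j.2⟩) (block M j i (s.1 i)) +
        (m M j * σ j)⁻¹ *
          inner ℝ (s.2 j ⟨i, mem_I_of_mem_J j.2⟩) (t.2 j ⟨i, mem_I_of_mem_J j.2⟩)))
    (fun s s' t => by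
      simp only [Prod.fst_add, Prod.snd_add, PiLp.add_apply, Pi.add_apply, map_add,
        inner_add_left, inner_add_right, mul_add, Finset.sum_add_distrib]
      ring)
    (fun c s t => by
      simp only [Prod.smul_fst, Prod.smul_snd, PiLp.smul_apply, Pi.smul_apply, map_smul,
        real_inner_smul_left, real_inner_smul_right, smul_eq_mul, mul_add, Finset.mul_sum]
      congr 1
      · ring
      · exact Finset.sum_congr rfl fun j _ => by ring)
    (fun s t t' => by
      simp only [Prod.fst_add, Prod.snd_add, PiLp.add_apply, Pi.add_apply, map_add,
        inner_add_left, inner_add_right, mul_add, Finset.sum_add_distrib]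
      ring)
    (fun c s t => by
      simp only [Prod.smul_fst, Prod.smul_snd, PiLp.smul_apply, Pi.smul_apply, map_smul,
        real_inner_smul_left, real_inner_smul_right, smul_eq_mul, mul_add, Finset.mul_sum]
      congr 1
      · ring
      · exact Finset.sum_congr rfl fun j _ => by ring)

variable {M : PiLp 2 E →ₗ[ℝ] PiLp 2 F} {τ : Fin n → ℝ} {σ : Fin p → ℝ}

theorem blockForm_apply (i : Fin n) (s t : Pair M) :
    blockForm M τ σ i s t = (τ i)⁻¹ * inner ℝ (s.1 i) (t.1 i) + ∑ j : J M i,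
      (inner ℝ (s.2 j ⟨i, mem_I_of_mem_J j.2⟩) (block M j i (t.1 i)) +
        inner ℝ (t.2 j ⟨i, mem_I_of_mem_J j.2⟩) (block M j i (s.1 i)) +
        (m M j * σ j)⁻¹ *
          inner ℝ (s.2 j ⟨i, mem_I_of_mem_J j.2⟩) (t.2 j ⟨i, mem_I_of_mem_J j.2⟩)) :=
  rfl

theorem blockForm_comm (i : Fin n) (s t : Pair M) :
    blockForm M τ σ i s t = blockForm M τ σ i t s := by
  rw [blockForm_apply, blockForm_apply, real_inner_comm]
  congr 1
  refine Finset.sum_congr rfl fun j _ => ?_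
  rw [real_inner_comm (t.2 j ⟨i, mem_I_of_mem_J j.2⟩)]
  ring

variable (M τ σ) in
/-- The metric `[D(τ)⁻¹, K⋆; K, D(m σ)⁻¹]` of the algorithm on the duplicated space, where
`(K x)_{j,i} = M_{j,i} x_i`. Thanks to the duplication it is the sum of its blocks. -/
noncomputable def form : Pair M →ₗ[ℝ] Pair M →ₗ[ℝ] ℝ :=
  ∑ i, blockForm M τ σ i

theorem form_apply (s t : Pair M) : form M τ σ s t = ∑ i, blockForm M τ σ i s t := by
  simp [form, LinearMap.sum_apply]

theorem form_comm (s t : Pair M) : form M τ σ s t = form M τ σ t s := by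
  rw [form_apply, form_apply]
  exact Finset.sum_congr rfl fun i _ => blockForm_comm i s t

/-- The squared norm of the coordinates of block `i`. -/
noncomputable def blockSq (i : Fin n) (s : Pair M) : ℝ :=
  ‖s.1 i‖ ^ 2 + ∑ j : J M i, ‖s.2 j ⟨i, mem_I_of_mem_J j.2⟩‖ ^ 2

theorem blockSq_nonneg (i : Fin n) (s : Pair M) : 0 ≤ blockSq i s := by
  unfold blockSq; positivity

theorem norm_sq_le_sum_blockSq (s : Pair M) : ‖s‖ ^ 2 ≤ ∑ i, blockSq i s := by
  have hsum : ∑ i, blockSq i s = ‖s.1‖ ^ 2 + ∑ j, ∑ i : I M j, ‖s.2 j i‖ ^ 2 := by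
    rw [sum_I_eq_sum_J M fun j i => ‖s.2 j i‖ ^ 2, PiLp.norm_sq_eq_of_L2,
      ← Finset.sum_add_distrib]
    rfl
  rw [hsum]
  have h2 : ∀ j (i : I M j), ‖s.2 j i‖ ^ 2 ≤ ∑ j, ∑ i : I M j, ‖s.2 j i‖ ^ 2 := by
    intro j i
    calc ‖s.2 j i‖ ^ 2 ≤ ∑ i : I M j, ‖s.2 j i‖ ^ 2 :=
          Finset.single_le_sum (f := fun i => ‖s.2 j i‖ ^ 2) (fun _ _ => sq_nonneg _)
            (Finset.mem_univ i)
      _ ≤ _ := Finset.single_le_sum (f := fun j => ∑ i : I M j, ‖s.2 j i‖ ^ 2)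
          (fun _ _ => Finset.sum_nonneg fun _ _ => sq_nonneg _) (Finset.mem_univ j)
  have h0 : 0 ≤ ∑ j, ∑ i : I M j, ‖s.2 j i‖ ^ 2 :=
    Finset.sum_nonneg fun _ _ => Finset.sum_nonneg fun _ _ => sq_nonneg _
  have h3 : ‖s.2‖ ≤ √(∑ j, ∑ i : I M j, ‖s.2 j i‖ ^ 2) := by
    refine (pi_norm_le_iff_of_nonneg (Real.sqrt_nonneg _)).2 fun j => ?_
    exact (pi_norm_le_iff_of_nonneg (Real.sqrt_nonneg _)).2 fun i => Real.le_sqrt_of_sq_le (h2 j i)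
  have h4 : ‖s.2‖ ^ 2 ≤ ∑ j, ∑ i : I M j, ‖s.2 j i‖ ^ 2 := by
    have := pow_le_pow_left₀ (norm_nonneg _) h3 2
    rwa [Real.sq_sqrt h0] at this
  rw [Prod.norm_def]
  rcases max_choice ‖s.1‖ ‖s.2‖ with h | h <;> rw [h]
  · linarith
  · linarith [sq_nonneg ‖s.1‖]

/-- The quadratic form of a block depends only on the coordinates of that block. -/
theorem blockForm_congr (i : Fin n) {s t : Pair M} (h1 : s.1 i = t.1 i)
    (h2 : ∀ (j : Fin p) (hi : i ∈ I M j), s.2 j ⟨i, hi⟩ = t.2 j ⟨i, hi⟩) :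
    blockForm M τ σ i s s = blockForm M τ σ i t t := by
  rw [blockForm_apply, blockForm_apply, h1]
  congr 1
  refine Finset.sum_congr rfl fun j _ => ?_
  rw [h2]

variable [∀ i, FiniteDimensional ℝ (E i)] [∀ j, FiniteDimensional ℝ (F j)]

theorem sum_mul_norm_block_sq_le (i : Fin n) (u : E i) :
    ∑ j : J M i, (m M j * σ j) * ‖block M j i u‖ ^ 2 ≤ stepRadius M σ i * ‖u‖ ^ 2 := by
  have hsymm : LinearMap.IsSymmetric
      (∑ j ∈ J M i, ((m M j : ℝ) * σ j) • ((block M j i).adjoint ∘ₗ block M j i) :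
        Module.End ℝ (E i)) := by
    intro u v
    simp only [LinearMap.sum_apply, sum_inner, inner_sum, LinearMap.smul_apply,
      LinearMap.comp_apply, real_inner_smul_left, real_inner_smul_right,
      LinearMap.adjoint_inner_left, LinearMap.adjoint_inner_right]
  refine le_trans (le_of_eq ?_) (inner_le_spectralRadius_mul hsymm u)
  rw [Finset.sum_coe_sort (J M i) fun j => (m M j * σ j) * ‖block M j i u‖ ^ 2]
  simp only [LinearMap.sum_apply, sum_inner, LinearMap.smul_apply,
      LinearMap.comp_apply, real_inner_smul_left, LinearMap.adjoint_inner_left,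
      real_inner_self_eq_norm_sq]

/-- The step size condition makes the `i`-th block of the metric, minus `β_i ‖·‖²` on the primal
coordinate, positive definite. -/
theorem exists_blockSq_le (hm : ∀ j, m M j ≠ 0) (hσ : ∀ j, 0 < σ j) (hτ : ∀ i, 0 < τ i)
    {β : Fin n → ℝ} (hstep : ∀ i, τ i * (β i + stepRadius M σ i) < 1) (i : Fin n) :
    ∃ c > 0, ∀ s : Pair M,
      c * blockSq i s ≤ blockForm M τ σ i s s - β i * ‖s.1 i‖ ^ 2 := by
  set ρ := stepRadius M σ i with hρdef
  have hρ : 0 ≤ ρ := ENNReal.toReal_nonneg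
  have hmσ : ∀ j, 0 < (m M j : ℝ) * σ j := fun j =>
    mul_pos (Nat.cast_pos.2 (Nat.pos_of_ne_zero (hm j))) (hσ j)
  obtain ⟨δ, hδ, hτδ⟩ : ∃ δ > 0, (τ i)⁻¹ = β i + ρ + δ := by
    refine ⟨(τ i)⁻¹ - (β i + ρ), ?_, by ring⟩
    have h1 := hstep i
    rw [← lt_div_iff₀' (hτ i), one_div] at h1
    linarith
  -- Young's inequality with weight `θ < 1` such that `ρ / θ ≤ ρ + δ / 2`
  obtain ⟨θ, hθ0, hθ1, hθ⟩ : ∃ θ : ℝ, 0 < θ ∧ θ < 1 ∧ ρ ≤ θ * (ρ + δ / 2) := by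
    refine ⟨(ρ + δ / 4) / (ρ + δ / 2), by positivity, ?_, ?_⟩
    · rw [div_lt_one (by positivity)]; linarith
    · rw [div_mul_cancel₀ _ (by positivity)]; linarith
  obtain ⟨κ, hκ0, hκ⟩ : ∃ κ > 0, ∀ j : Fin p, 0 + κ < ((m M j : ℝ) * σ j)⁻¹ :=
    Pi.exists_forall_pos_add_lt (x := fun _ => 0) fun j => inv_pos.2 (hmσ j)
  refine ⟨min (δ / 2) ((1 - θ) * κ), lt_min (by positivity) (mul_pos (by linarith) hκ0),
    fun s => ?_⟩
  set c := min (δ / 2) ((1 - θ) * κ) with hc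
  have hYoung : ∀ j : J M i,
      c * ‖s.2 j ⟨i, mem_I_of_mem_J j.2⟩‖ ^ 2 -
        θ⁻¹ * ((m M j * σ j) * ‖block M j i (s.1 i)‖ ^ 2) ≤
      inner ℝ (s.2 j ⟨i, mem_I_of_mem_J j.2⟩) (block M j i (s.1 i)) +
        inner ℝ (s.2 j ⟨i, mem_I_of_mem_J j.2⟩) (block M j i (s.1 i)) +
        (m M j * σ j)⁻¹ *
          inner ℝ (s.2 j ⟨i, mem_I_of_mem_J j.2⟩) (s.2 j ⟨i, mem_I_of_mem_J j.2⟩) := by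
    intro j
    set y := s.2 j ⟨i, mem_I_of_mem_J j.2⟩
    set v := block M j i (s.1 i)
    set q := (m M j : ℝ) * σ j with hq
    have hq0 : 0 < q := hmσ j
    have h1 : c ≤ (1 - θ) * q⁻¹ := (min_le_right _ _).trans
      (mul_le_mul_of_nonneg_left (by linarith [hκ j]) (by linarith))
    have h2 : 0 ≤ θ * q⁻¹ * ‖y + (θ⁻¹ * q) • v‖ ^ 2 := by positivity
    rw [norm_add_sq_real, norm_smul, real_inner_smul_right, mul_pow, Real.norm_eq_abs, sq_abs]
      at h2
    have h3 : θ * q⁻¹ * (‖y‖ ^ 2 + 2 * (θ⁻¹ * q * inner ℝ y v) + (θ⁻¹ * q) ^ 2 * ‖v‖ ^ 2) =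
        θ * q⁻¹ * ‖y‖ ^ 2 + 2 * inner ℝ y v + θ⁻¹ * (q * ‖v‖ ^ 2) := by
      field_simp
    rw [h3] at h2
    rw [real_inner_self_eq_norm_sq]
    have h4 := mul_le_mul_of_nonneg_right h1 (sq_nonneg ‖y‖)
    linarith
  have hsum := Finset.sum_le_sum fun j (_ : j ∈ Finset.univ) => hYoung j
  rw [Finset.sum_sub_distrib, ← Finset.mul_sum, ← Finset.mul_sum] at hsum
  have hM := sum_mul_norm_block_sq_le (M := M) (σ := σ) i (s.1 i)
  have hM' : θ⁻¹ * ∑ j : J M i, (m M j * σ j) * ‖block M j i (s.1 i)‖ ^ 2 ≤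
      (ρ + δ / 2) * ‖s.1 i‖ ^ 2 := by
    rw [inv_mul_le_iff₀ hθ0, ← mul_assoc]
    exact hM.trans (mul_le_mul_of_nonneg_right hθ (sq_nonneg _))
  have hcδ : c * ‖s.1 i‖ ^ 2 ≤ δ / 2 * ‖s.1 i‖ ^ 2 :=
    mul_le_mul_of_nonneg_right (min_le_left _ _) (sq_nonneg _)
  rw [blockForm_apply, blockSq, mul_add, hτδ, real_inner_self_eq_norm_sq]
  have : (β i + ρ + δ) * ‖s.1 i‖ ^ 2 - β i * ‖s.1 i‖ ^ 2 = (ρ + δ / 2) * ‖s.1 i‖ ^ 2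
      + δ / 2 * ‖s.1 i‖ ^ 2 := by ring
  linarith

theorem exists_norm_sq_le_form (hm : ∀ j, m M j ≠ 0) (hσ : ∀ j, 0 < σ j) (hτ : ∀ i, 0 < τ i)
    {β : Fin n → ℝ} (hstep : ∀ i, τ i * (β i + stepRadius M σ i) < 1) :
    ∃ c > 0, ∀ s : Pair M, c * ‖s‖ ^ 2 ≤ form M τ σ s s - ∑ i, β i * ‖s.1 i‖ ^ 2 := by
  choose c hc0 hc using exists_blockSq_le (M := M) hm hσ hτ hstep
  obtain ⟨κ, hκ0, hκ⟩ : ∃ κ > 0, ∀ i, 0 + κ < c i :=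
    Pi.exists_forall_pos_add_lt (x := fun _ => 0) hc0
  refine ⟨κ, hκ0, fun s => ?_⟩
  rw [form_apply, ← Finset.sum_sub_distrib]
  calc κ * ‖s‖ ^ 2 ≤ κ * ∑ i, blockSq i s :=
        mul_le_mul_of_nonneg_left (norm_sq_le_sum_blockSq s) hκ0.le
    _ = ∑ i, κ * blockSq i s := Finset.mul_sum _ _ _
    _ ≤ _ := Finset.sum_le_sum fun i _ =>
        (mul_le_mul_of_nonneg_right (by linarith [hκ i]) (blockSq_nonneg i s)).trans (hc i s)

theorem inner_initState_w (x v : PiLp 2 E) (y : (j : Fin p) → I M j → F j) :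
    inner ℝ (initState M x y).w v = ∑ j, ∑ i : I M j, inner ℝ (y j i) (block M j i (v i)) := by
  rw [sum_I_eq_sum_J M fun j i => inner ℝ (y j i) (block M j i (v i)), PiLp.inner_apply]
  refine Finset.sum_congr rfl fun i _ => ?_
  simp only [initState, sum_inner, LinearMap.adjoint_inner_left]

/-- The metric paired with a point whose dual copies all agree only involves the aggregated
variables `w` and `z` of the algorithm. -/
theorem form_dup (x v : PiLp 2 E) (y : (j : Fin p) → I M j → F j)
    (η : PiLp 2 F) :
    form M τ σ (x, y) (v, dup M η) =
      inner ℝ (diag (fun i => (τ i)⁻¹) x) v + inner ℝ (initState M x y).w v +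
        inner ℝ η (M x) + inner ℝ (diag (fun j => (σ j)⁻¹) (initState M x y).z) η := by
  have h2 : inner ℝ (diag (fun j => (σ j)⁻¹) (initState M x y).z) η =
      ∑ j, ∑ i : I M j, (m M j * σ j)⁻¹ * inner ℝ (y j i) (η j) := by
    rw [PiLp.inner_apply]
    refine Finset.sum_congr rfl fun j _ => ?_
    simp only [diag_apply, initState, real_inner_smul_left, sum_inner, ← Finset.mul_sum]
    rw [mul_inv]
    ring
  have h3 : inner ℝ (diag (fun i => (τ i)⁻¹) x) v = ∑ i, (τ i)⁻¹ * inner ℝ (x i) (v i) := by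
    simp only [PiLp.inner_apply, diag_apply, real_inner_smul_left]
  rw [inner_map_eq_sum_block, h2, h3, inner_initState_w, form_apply, sum_I_eq_sum_J, sum_I_eq_sum_J M fun j i =>
    inner ℝ (η j) (block M j i (x i)), sum_I_eq_sum_J, ← Finset.sum_add_distrib,
    ← Finset.sum_add_distrib, ← Finset.sum_add_distrib]
  refine Finset.sum_congr rfl fun i _ => ?_
  simp only [blockForm_apply, dup, Finset.sum_add_distrib]
  ring

end Form

end CDPrimalDual

/-! ### Average decrease of the Lyapunov function -/

namespace CDPrimalDual

variable {n p : ℕ} {E : Fin n → Type*} {F : Fin p → Type*}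
  [∀ i, NormedAddCommGroup (E i)] [∀ i, InnerProductSpace ℝ (E i)]
  [∀ j, NormedAddCommGroup (F j)] [∀ j, InnerProductSpace ℝ (F j)]

section DualStep

variable {h : PiLp 2 F → EReal} {M : PiLp 2 E →ₗ[ℝ] PiLp 2 F} {σ : Fin p → ℝ}

theorem exists_yBar_le [∀ j, FiniteDimensional ℝ (F j)] (hh : IsClosedProperConvex h) (hσ : ∀ j, 0 < σ j) (s : State M) :
    ∃ b : ℝ, conj h (yBar h M σ s) = b ∧ ∀ (z : PiLp 2 F) (r : ℝ), conj h z ≤ r →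
      b + (inner ℝ (diag (fun j => (σ j)⁻¹) (s.z - yBar h M σ s)) (z - yBar h M σ s) +
        inner ℝ (z - yBar h M σ s) (M s.x)) ≤ r := by
  obtain ⟨b, hb, hle⟩ := hh.conj.le_of_isProx (hh.conj.isProx_prox hσ (s.z + diag σ (M s.x)))
  refine ⟨b, hb, fun v r hr => ?_⟩
  have h1 := hle v r hr
  change b + inner ℝ (diag _ (_ - yBar h M σ s)) (v - yBar h M σ s) ≤ r at h1
  rw [diag_inv_add hσ, inner_add_left, real_inner_comm _ (M s.x)] at h1
  linarith

end DualStep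

variable [∀ i, FiniteDimensional ℝ (E i)] [∀ j, FiniteDimensional ℝ (F j)]

section Dynamics

variable (f : PiLp 2 E → ℝ) (g : PiLp 2 E → EReal) (h : PiLp 2 F → EReal)
  {M : PiLp 2 E →ₗ[ℝ] PiLp 2 F} (τ : Fin n → ℝ) (σ : Fin p → ℝ)

/-- The state of the algorithm determined by the primal variables and the dual copies. -/
noncomputable def pairState (s : Pair M) : State M := initState M s.1 s.2

/-- The full (non-randomized) primal-dual update `(x̄, ȳ, …, ȳ)` computed at a state. -/
noncomputable def fullUpdate (s : Pair M) : Pair M :=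
  (xBar f g h M τ σ (pairState s), dup M (yBar h M σ (pairState s)))

/-- The update of the primal coordinate `i` and of the dual copies attached to it. -/
noncomputable def coordUpdate (i : Fin n) (s : Pair M) : Pair M :=
  ((step f g h M τ σ i (pairState s)).x, (step f g h M τ σ i (pairState s)).yy)

/-- The auxiliary variables `w` and `z` remain the aggregates of the dual copies. -/
theorem step_pairState (i : Fin n) (s : Pair M) :
    step f g h M τ σ i (pairState s) = pairState (coordUpdate f g h τ σ i s) := by
  have hw : (step f g h M τ σ i (pairState s)).w =
      (pairState (coordUpdate f g h τ σ i s)).w := by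
    ext l
    by_cases hl : l = i
    · subst hl
      simp [step, pairState, coordUpdate, initState]
    · simp [step, pairState, coordUpdate, initState, nextYY, hl]
  have hz : (step f g h M τ σ i (pairState s)).z =
      (pairState (coordUpdate f g h τ σ i s)).z := by
    ext j
    by_cases hi : i ∈ I M j
    · have hsum : ∑ i' : I M j, nextYY h M σ i (pairState s) j i' =
          ∑ i' : I M j, s.2 j i' +
            (nextYY h M σ i (pairState s) j ⟨i, hi⟩ - s.2 j ⟨i, hi⟩) := by
        rw [← Finset.add_sum_erase _ _ (Finset.mem_univ (⟨i, hi⟩ : I M j)),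
          ← Finset.add_sum_erase _ (fun i' => s.2 j i') (Finset.mem_univ (⟨i, hi⟩ : I M j))]
        have : ∑ i' ∈ Finset.univ.erase (⟨i, hi⟩ : I M j), nextYY h M σ i (pairState s) j i' =
            ∑ i' ∈ Finset.univ.erase (⟨i, hi⟩ : I M j), s.2 j i' := by
          refine Finset.sum_congr rfl fun i' hi' => ?_
          have hne : (i' : Fin n) ≠ i := fun heq => (Finset.mem_erase.1 hi').1 (Subtype.ext heq)
          simp [nextYY, hne, pairState, initState]
        rw [this]
        abel
      change (if hi : i ∈ I M j then _ else _) =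
        (1 / (m M j : ℝ)) • ∑ i' : I M j, nextYY h M σ i (pairState s) j i'
      rw [dif_pos hi, hsum, smul_add]
      rfl
    · change (if hi : i ∈ I M j then _ else _) =
        (1 / (m M j : ℝ)) • ∑ i' : I M j, nextYY h M σ i (pairState s) j i'
      rw [dif_neg hi]
      change (1 / (m M j : ℝ)) • ∑ i' : I M j, s.2 j i' = _
      congr 1
      refine Finset.sum_congr rfl fun i' _ => ?_
      have hne : (i' : Fin n) ≠ i := fun heq => hi (heq ▸ i'.2)
      simp [nextYY, hne, pairState, initState]
  calc step f g h M τ σ i (pairState s) = ⟨(step f g h M τ σ i (pairState s)).x,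
        (step f g h M τ σ i (pairState s)).w, (step f g h M τ σ i (pairState s)).z,
        (step f g h M τ σ i (pairState s)).yy⟩ := rfl
    _ = _ := by rw [hw, hz]; rfl

/-- The trajectory of the primal variables and the dual copies. -/
noncomputable def trajectory (s₀ : Pair M) (idx : ℕ → Fin n) : ℕ → Pair M
  | 0 => s₀
  | k + 1 => coordUpdate f g h τ σ (idx k) (trajectory s₀ idx k)

theorem iterates_eq (x₀ : PiLp 2 E) (yy₀ : (j : Fin p) → I M j → F j) (idx : ℕ → Fin n) (k : ℕ) :
    iterates f g h M τ σ x₀ yy₀ idx k =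
      pairState (trajectory f g h τ σ (x₀, yy₀) idx k) := by
  induction k with
  | zero => rfl
  | succ k ih => rw [iterates, ih, step_pairState]; rfl

theorem coordUpdate_fst_apply (i l : Fin n) (s : Pair M) :
    (coordUpdate f g h τ σ i s).1 l = if l = i then (fullUpdate f g h τ σ s).1 l else s.1 l := by
  by_cases hl : l = i
  · subst hl; simp [coordUpdate, step, fullUpdate]
  · simp [coordUpdate, step, hl, pairState, initState]

theorem coordUpdate_fst (i : Fin n) (s : Pair M) :
    (coordUpdate f g h τ σ i s).1 =
      s.1 + PiLp.single 2 i (((fullUpdate f g h τ σ s).1 - s.1) i) := by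
  ext l
  rw [coordUpdate_fst_apply]
  by_cases hl : l = i
  · subst hl; simp
  · simp [hl]

theorem coordUpdate_snd_apply (i : Fin n) (s : Pair M) (j : Fin p) (l : I M j) :
    (coordUpdate f g h τ σ i s).2 j l =
      if (l : Fin n) = i then (fullUpdate f g h τ σ s).2 j l else s.2 j l := rfl

/-- Since the metric is block diagonal, averaging over the coordinate updates interpolates between
the current point and the full update. -/
theorem sum_form_coordUpdate (s t : Pair M) :
    ∑ i, form M τ σ (coordUpdate f g h τ σ i s - t) (coordUpdate f g h τ σ i s - t) =
      (n - 1) * form M τ σ (s - t) (s - t) +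
        form M τ σ (fullUpdate f g h τ σ s - t) (fullUpdate f g h τ σ s - t) := by
  have hb : ∀ i l, blockForm M τ σ l (coordUpdate f g h τ σ i s - t)
      (coordUpdate f g h τ σ i s - t) = blockForm M τ σ l (s - t) (s - t) +
        if l = i then blockForm M τ σ l (fullUpdate f g h τ σ s - t)
          (fullUpdate f g h τ σ s - t) - blockForm M τ σ l (s - t) (s - t) else 0 := by
    intro i l
    by_cases hl : l = i
    · rw [if_pos hl, add_sub_cancel]
      refine blockForm_congr l ?_ fun j hj => ?_
      · simp [coordUpdate_fst_apply, hl]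
      · simp [coordUpdate_snd_apply, hl]
    · rw [if_neg hl, add_zero]
      refine blockForm_congr l ?_ fun j hj => ?_
      · simp [coordUpdate_fst_apply, hl]
      · simp [coordUpdate_snd_apply, hl]
  simp only [form_apply, hb, Finset.sum_add_distrib, Finset.sum_ite_eq', Finset.mem_univ, if_true]
  rw [Finset.sum_comm]
  simp only [Finset.sum_const, Finset.card_univ, Fintype.card_fin, nsmul_eq_mul,
    Finset.sum_sub_distrib, ← Finset.mul_sum]
  ring

end Dynamics

section Descent

variable {f : PiLp 2 E → ℝ} {g : PiLp 2 E → EReal} {h : PiLp 2 F → EReal}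
  {M : PiLp 2 E →ₗ[ℝ] PiLp 2 F} {τ : Fin n → ℝ} {σ : Fin p → ℝ}

theorem exists_xBar_le (hg : IsClosedProperConvex g) (hτ : ∀ i, 0 < τ i) (s : State M) :
    ∃ a : ℝ, g (xBar f g h M τ σ s) = a ∧ ∀ (v : PiLp 2 E) (r : ℝ), g v ≤ r →
      a + (inner ℝ (diag (fun i => (τ i)⁻¹) (s.x - xBar f g h M τ σ s)) (v - xBar f g h M τ σ s) -
        inner ℝ (grad f s.x) (v - xBar f g h M τ σ s) -
        2 * inner ℝ (yBar h M σ s) (M (v - xBar f g h M τ σ s)) +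
        inner ℝ s.w (v - xBar f g h M τ σ s)) ≤ r := by
  obtain ⟨a, ha, hle⟩ := hg.le_of_isProx (hg.isProx_prox hτ
    (s.x - diag τ (grad f s.x + (2 : ℝ) • M.adjoint (yBar h M σ s) - s.w)))
  refine ⟨a, ha, fun v r hr => ?_⟩
  have h1 := hle v r hr
  change a + inner ℝ (diag _ (_ - xBar f g h M τ σ s)) (v - xBar f g h M τ σ s) ≤ r at h1
  rw [diag_inv_sub hτ, inner_sub_left, inner_sub_left, inner_add_left, real_inner_smul_left,
    LinearMap.adjoint_inner_left] at h1
  linarith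

theorem inner_pairState_w_sub_dup (x x' v : PiLp 2 E) (y : (j : Fin p) → I M j → F j)
    (η : PiLp 2 F) :
    inner ℝ (initState M x (y - dup M η)).w v =
      inner ℝ (initState M x' y).w v - inner ℝ η (M v) := by
  rw [inner_initState_w, inner_initState_w, inner_map_eq_sum_block]
  simp only [Pi.sub_apply, dup, inner_sub_left, Finset.sum_sub_distrib]

theorem initState_z_sub_dup (hm : ∀ j, m M j ≠ 0) (x x' : PiLp 2 E)
    (y : (j : Fin p) → I M j → F j) (η : PiLp 2 F) :
    (initState M x (y - dup M η)).z = (initState M x' y).z - η := by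
  ext j
  have : (m M j : ℝ) ≠ 0 := Nat.cast_ne_zero.2 (hm j)
  have hcard : (Finset.univ : Finset (I M j)).card = m M j := by simp [m]
  simp only [initState, Pi.sub_apply, dup, Finset.sum_sub_distrib, Finset.sum_const, smul_sub,
    PiLp.sub_apply, hcard]
  rw [← Nat.cast_smul_eq_nsmul ℝ, smul_smul, one_div_mul_cancel this, one_smul]

/-- The fundamental inequality of the full primal-dual step: combine the variational inequalities
of the two proximal steps with the optimality conditions of a saddle point. -/
theorem inner_grad_le_form (hm : ∀ j, m M j ≠ 0) (hf' : Differentiable ℝ f)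
    (hg : IsClosedProperConvex g) (hh : IsClosedProperConvex h) (hσ : ∀ j, 0 < σ j)
    (hτ : ∀ i, 0 < τ i) {xs : PiLp 2 E} {ys : PiLp 2 F} (hS : (xs, ys) ∈ saddlePoints f g h M)
    (s : Pair M) :
    inner ℝ (grad f s.1 - grad f xs) ((fullUpdate f g h τ σ s).1 - xs) ≤
      form M τ σ (s - fullUpdate f g h τ σ s) (fullUpdate f g h τ σ s - (xs, dup M ys)) := by
  obtain ⟨a, b, ha, hb, hx, hy⟩ := (mem_saddlePoints_iff hg hh).1 hS
  obtain ⟨a', ha', hx'⟩ := exists_xBar_le (f := f) (h := h) (σ := σ) hg hτ (pairState s)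
  obtain ⟨b', hb', hy'⟩ := exists_yBar_le (M := M) hh hσ (pairState s)
  have h1 := hx' xs a ha.le
  have h2 := primal_optimality hf' hg ha hx ha'.le
  have h3 := hy' ys b hb.le
  have h4 := hy _ b' hb'.le
  have hform : form M τ σ (s - fullUpdate f g h τ σ s)
      (fullUpdate f g h τ σ s - (xs, dup M ys)) =
      form M τ σ (s.1 - xBar f g h M τ σ (pairState s), s.2 - dup M (yBar h M σ (pairState s)))
        (xBar f g h M τ σ (pairState s) - xs, dup M (yBar h M σ (pairState s) - ys)) := rfl
  rw [hform, form_dup, inner_pairState_w_sub_dup _ s.1, initState_z_sub_dup hm _ s.1]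
  change inner ℝ (grad f s.1 - grad f xs) (xBar f g h M τ σ (pairState s) - xs) ≤ _
  have e1 : (pairState s).x = s.1 := rfl
  have e2 : initState M s.1 s.2 = pairState s := rfl
  rw [e2]
  rw [e1] at h1 h3
  generalize xBar f g h M τ σ (pairState s) = xb at *
  generalize yBar h M σ (pairState s) = yb at *
  rw [real_inner_comm] at h4
  simp only [map_sub, inner_sub_left, inner_sub_right] at h1 h2 h3 h4 ⊢
  linarith

theorem sum_comp_coordUpdate_le {β : Fin n → ℝ}
    (hsmooth : ∀ (i : Fin n) (x : PiLp 2 E) (u : E i),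
      f (x + PiLp.single 2 i u) ≤
        f x + inner ℝ (grad f x) (PiLp.single 2 i u) + β i / 2 * ‖u‖ ^ 2) (s : Pair M) :
    ∑ i, f (coordUpdate f g h τ σ i s).1 ≤ n * f s.1 +
      inner ℝ (grad f s.1) ((fullUpdate f g h τ σ s).1 - s.1) +
      1 / 2 * ∑ i, β i * ‖(s - fullUpdate f g h τ σ s).1 i‖ ^ 2 := by
  calc ∑ i, f (coordUpdate f g h τ σ i s).1
      ≤ ∑ i, (f s.1 + inner ℝ (grad f s.1)
          (PiLp.single 2 i (((fullUpdate f g h τ σ s).1 - s.1) i)) +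
          β i / 2 * ‖((fullUpdate f g h τ σ s).1 - s.1) i‖ ^ 2) :=
        Finset.sum_le_sum fun i _ => by
          rw [coordUpdate_fst]; exact hsmooth i s.1 _
    _ = _ := by
        rw [Finset.sum_add_distrib, Finset.sum_add_distrib, ← inner_sum, sum_single,
          Finset.mul_sum]
        congr 1
        · simp
        · refine Finset.sum_congr rfl fun i _ => ?_
          rw [PiLp.sub_apply, norm_sub_rev, Prod.fst_sub, PiLp.sub_apply]
          ring

variable (f M τ σ) in
/-- The Lyapunov function attached to a reference point: half the squared distance for the metric
plus the Bregman divergence of `f`. -/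
noncomputable def lyapunov (t s : Pair M) : ℝ :=
  1 / 2 * form M τ σ (s - t) (s - t) + (f s.1 - f t.1 - inner ℝ (grad f t.1) (s.1 - t.1))

/-- The Lyapunov function decreases in average along a coordinate update. -/
theorem sum_lyapunov_coordUpdate_le (hm : ∀ j, m M j ≠ 0) (hf : ConvexOn ℝ Set.univ f)
    (hf' : Differentiable ℝ f)
    (hg : IsClosedProperConvex g) (hh : IsClosedProperConvex h) (hσ : ∀ j, 0 < σ j)
    (hτ : ∀ i, 0 < τ i) {β : Fin n → ℝ}
    (hsmooth : ∀ (i : Fin n) (x : PiLp 2 E) (u : E i),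
      f (x + PiLp.single 2 i u) ≤
        f x + inner ℝ (grad f x) (PiLp.single 2 i u) + β i / 2 * ‖u‖ ^ 2)
    {xs : PiLp 2 E} {ys : PiLp 2 F} (hS : (xs, ys) ∈ saddlePoints f g h M) (s : Pair M) :
    ∑ i, lyapunov f M τ σ (xs, dup M ys) (coordUpdate f g h τ σ i s) ≤
      n * lyapunov f M τ σ (xs, dup M ys) s -
        1 / 2 * (form M τ σ (s - fullUpdate f g h τ σ s) (s - fullUpdate f g h τ σ s) -
          ∑ i, β i * ‖(s - fullUpdate f g h τ σ s).1 i‖ ^ 2) := by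
  set t : Pair M := (xs, dup M ys) with ht
  set u := fullUpdate f g h τ σ s with hu
  have h1 := sum_form_coordUpdate f g h τ σ s t
  have h2 := sum_comp_coordUpdate_le (g := g) (h := h) (τ := τ) (σ := σ) hsmooth s
  have h3 := inner_grad_le_form hm hf' hg hh hσ hτ hS s
  have h4 := inner_grad_sub_nonneg hf hf' s.1 xs
  have h5 : ∑ i, inner ℝ (grad f xs) ((coordUpdate f g h τ σ i s).1 - xs) =
      n * inner ℝ (grad f xs) (s.1 - xs) + inner ℝ (grad f xs) (u.1 - s.1) := by
    have hup : ∀ i, (coordUpdate f g h τ σ i s).1 - xs =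
        (s.1 - xs) + PiLp.single 2 i ((u.1 - s.1) i) := fun i => by
      rw [coordUpdate_fst, ← hu]; abel
    simp only [hup, inner_add_right, Finset.sum_add_distrib]
    rw [← inner_sum Finset.univ (fun i => PiLp.single 2 i ((u.1 - s.1) i)), sum_single]
    simp
  have h6 : form M τ σ (s - t) (s - t) = form M τ σ (s - u) (s - u) + form M τ σ (u - t) (u - t) +
      2 * form M τ σ (s - u) (u - t) := by
    have : s - t = (s - u) + (u - t) := by abel
    rw [this]
    simp only [map_add, LinearMap.add_apply]
    rw [form_comm (u - t) (s - u)]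
    ring
  rw [← hu] at h1 h2 h3
  simp only [lyapunov, Finset.sum_add_distrib, Finset.sum_sub_distrib, ← Finset.mul_sum, h1,
    Finset.sum_const, Finset.card_univ, Fintype.card_fin, nsmul_eq_mul]
  change _ ≤ n * (1 / 2 * form M τ σ (s - t) (s - t) +
    (f s.1 - f xs - inner ℝ (grad f xs) (s.1 - xs))) - _
  have h7 : inner ℝ (grad f s.1 - grad f xs) (u.1 - xs) =
      inner ℝ (grad f s.1) (u.1 - s.1) - inner ℝ (grad f xs) (u.1 - s.1) +
        inner ℝ (grad f s.1 - grad f xs) (s.1 - xs) := by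
    simp only [inner_sub_left, inner_sub_right]
    ring
  have e : t.1 = xs := rfl
  rw [e, h5]
  rw [h7] at h3
  linarith

end Descent

end CDPrimalDual

/-! ### Random recursions with uniform independent draws -/

namespace CDPrimalDual

section RandomRecursion

variable {S Ω : Type*} {n : ℕ} {idx : ℕ → Ω → Fin n} {step : Fin n → S → S} {X : ℕ → Ω → S} {s₀ : S}

theorem finite_range_recursion (h0 : ∀ ω, X 0 ω = s₀)
    (hX : ∀ k ω, X (k + 1) ω = step (idx k ω) (X k ω)) (k : ℕ) : (Set.range (X k)).Finite := by
  induction k with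
  | zero =>
    refine (Set.finite_singleton s₀).subset ?_
    rintro _ ⟨ω, rfl⟩
    exact h0 ω
  | succ k ih =>
    refine (Set.finite_iUnion fun i : Fin n => ih.image (step i)).subset ?_
    rintro _ ⟨ω, rfl⟩
    exact Set.mem_iUnion.2 ⟨idx k ω, X k ω, ⟨ω, rfl⟩, (hX k ω).symm⟩

/-- The `k`-th state is a function of the first `k` draws; the state space needs no measurable
structure since there are finitely many outcomes. -/
theorem measurableSet_preimage_recursion (h0 : ∀ ω, X 0 ω = s₀)
    (hX : ∀ k ω, X (k + 1) ω = step (idx k ω) (X k ω)) (m' : MeasurableSpace Ω) (k : ℕ)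
    (hm : ∀ j < k, Measurable[m'] (idx j)) (B : Set S) : MeasurableSet[m'] (X k ⁻¹' B) := by
  induction k generalizing B with
  | zero =>
    have : X 0 ⁻¹' B = {_ω | s₀ ∈ B} := by ext ω; simp [h0]
    rw [this]
    exact MeasurableSet.const _
  | succ k ih =>
    have : X (k + 1) ⁻¹' B = ⋃ i : Fin n, idx k ⁻¹' {i} ∩ X k ⁻¹' (step i ⁻¹' B) := by
      ext ω; simp [hX]
    rw [this]
    exact MeasurableSet.iUnion fun i => (hm k (Nat.lt_succ_self k) (measurableSet_singleton i)).inter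
      (ih (fun j hj => hm j (hj.trans (Nat.lt_succ_self k))) _)

theorem measurable_comp_recursion (h0 : ∀ ω, X 0 ω = s₀)
    (hX : ∀ k ω, X (k + 1) ω = step (idx k ω) (X k ω)) (m' : MeasurableSpace Ω) (k : ℕ)
    (hm : ∀ j < k, Measurable[m'] (idx j)) (G : S → ℝ) : Measurable[m'] fun ω => G (X k ω) :=
  fun B _ => measurableSet_preimage_recursion h0 hX m' k hm (G ⁻¹' B)

variable [mΩ : MeasurableSpace Ω] {μ : Measure Ω}

theorem integrable_comp_recursion [IsProbabilityMeasure μ]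
    (hmeas : ∀ k, Measurable (idx k)) (h0 : ∀ ω, X 0 ω = s₀)
    (hX : ∀ k ω, X (k + 1) ω = step (idx k ω) (X k ω)) (k : ℕ) (G : S → ℝ) :
    Integrable (fun ω => G (X k ω)) μ := by
  obtain ⟨C, hC⟩ := ((finite_range_recursion h0 hX k).image fun s => ‖G s‖).bddAbove
  exact Integrable.of_bound
    (measurable_comp_recursion h0 hX mΩ k (fun j _ => hmeas j) G).aestronglyMeasurable C
    (Eventually.of_forall fun ω => hC ⟨X k ω, ⟨ω, rfl⟩, rfl⟩)

/-- The σ-algebra generated by the draws before time `k`. -/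
def pastFiltration (hmeas : ∀ k, Measurable (idx k)) : Filtration ℕ mΩ where
  seq k := ⨆ j ∈ {j | j < k}, MeasurableSpace.comap (idx j) inferInstance
  mono' _ _ hkl := biSup_mono fun _ hj => lt_of_lt_of_le hj hkl
  le' _ := iSup₂_le fun j _ => (hmeas j).comap_le

theorem measurable_pastFiltration (hmeas : ∀ k, Measurable (idx k)) {j k : ℕ} (hj : j < k) :
    Measurable[pastFiltration hmeas k] (idx j) := by
  refine Measurable.mono (comap_measurable (idx j)) ?_ le_rfl
  exact le_iSup₂ (f := fun j (_ : j ∈ {j | j < k}) =>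
    MeasurableSpace.comap (idx j) inferInstance) j hj

theorem indep_pastFiltration (hmeas : ∀ k, Measurable (idx k)) (hindep : iIndepFun idx μ) (k : ℕ) :
    Indep (pastFiltration hmeas k) (MeasurableSpace.comap (idx k) inferInstance) μ := by
  suffices Indep (⨆ j ∈ {j | j < k}, MeasurableSpace.comap (idx j) inferInstance)
      (⨆ j ∈ ({k} : Set ℕ), MeasurableSpace.comap (idx j) inferInstance) μ by
    rwa [iSup_singleton] at this
  exact indep_iSup_of_disjoint (fun j => (hmeas j).comap_le) hindep (by simp)

/-- Conditionally on the past, the next state is uniformly distributed among the `n` possible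
ones. -/
theorem setIntegral_comp_recursion_succ [IsProbabilityMeasure μ]
    (hmeas : ∀ k, Measurable (idx k))
    (hindep : iIndepFun idx μ) (hunif : ∀ k i, μ {ω | idx k ω = i} = (n : ENNReal)⁻¹)
    (h0 : ∀ ω, X 0 ω = s₀) (hX : ∀ k ω, X (k + 1) ω = step (idx k ω) (X k ω)) (k : ℕ) (G : S → ℝ)
    {A : Set Ω} (hA : MeasurableSet[pastFiltration hmeas k] A) :
    ∫ ω in A, G (X (k + 1) ω) ∂μ = ∫ ω in A, (n : ℝ)⁻¹ * ∑ i, G (step i (X k ω)) ∂μ := by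
  have hA' : MeasurableSet A := (pastFiltration hmeas).le k A hA
  have hint : ∀ i, Integrable (fun ω => G (step i (X k ω))) μ := fun i =>
    integrable_comp_recursion hmeas h0 hX k fun s => G (step i s)
  have hB : ∀ i, MeasurableSet (idx k ⁻¹' {i}) := fun i => hmeas k (measurableSet_singleton i)
  have key : ∀ i, ∫ ω in A, (idx k ⁻¹' {i}).indicator (fun ω => G (step i (X k ω))) ω ∂μ =
      (n : ℝ)⁻¹ * ∫ ω in A, G (step i (X k ω)) ∂μ := by
    intro i
    set U : Ω → ℝ := A.indicator fun ω => G (step i (X k ω)) with hU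
    set W : Ω → ℝ := (idx k ⁻¹' {i}).indicator fun _ => 1 with hW
    have hUm : Measurable[pastFiltration hmeas k] U :=
      (measurable_comp_recursion h0 hX _ k
        (fun j hj => measurable_pastFiltration hmeas hj) fun s => G (step i s)).indicator hA
    have hWm : Measurable[MeasurableSpace.comap (idx k) inferInstance] W :=
      measurable_const.indicator ⟨{i}, measurableSet_singleton i, rfl⟩
    have hind : IndepFun U W μ :=
      indep_of_indep_of_le_right (indep_of_indep_of_le_left (indep_pastFiltration hmeas hindep k)
        hUm.comap_le) hWm.comap_le
    have h1 := hind.integral_mul_eq_mul_integral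
      (hUm.mono ((pastFiltration hmeas).le k) le_rfl).aestronglyMeasurable
      (hWm.mono (hmeas k).comap_le le_rfl).aestronglyMeasurable
    have h2 : ∫ ω, W ω ∂μ = (n : ℝ)⁻¹ := by
      rw [hW, integral_indicator_const _ (hB i), Measure.real]
      have : μ (idx k ⁻¹' {i}) = (n : ENNReal)⁻¹ := hunif k i
      rw [this]
      simp
    rw [h2, hU, integral_indicator hA'] at h1
    rw [mul_comm, ← h1, ← integral_indicator hA']
    refine integral_congr_ae (Eventually.of_forall fun ω => ?_)
    by_cases h3 : ω ∈ A <;> by_cases h4 : idx k ω = i <;> simp [W, Set.indicator, h3, h4]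
  have hsum : ∀ ω, G (X (k + 1) ω) =
      ∑ i, (idx k ⁻¹' {i}).indicator (fun ω => G (step i (X k ω))) ω := by
    intro ω
    simp [Set.indicator, hX]
  simp only [hsum]
  rw [integral_finsetSum _ fun i _ => ((hint i).indicator (hB i)).integrableOn,
    integral_const_mul, integral_finsetSum _ fun i _ => (hint i).integrableOn, Finset.mul_sum]
  exact Finset.sum_congr rfl fun i _ => key i

/-- A Robbins–Siegmund lemma for random recursions: a nonnegative function which decreases in
average along the recursion converges almost surely, and the decrements are summable. Both follow
from the convergence of the nonnegative supermartingale `V (X k) + ∑ l < k, D (X l)`. -/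
theorem ae_tendsto_and_summable_of_sum_le [IsProbabilityMeasure μ]
    (hmeas : ∀ k, Measurable (idx k))
    (hindep : iIndepFun idx μ) (hunif : ∀ k i, μ {ω | idx k ω = i} = (n : ENNReal)⁻¹)
    (h0 : ∀ ω, X 0 ω = s₀) (hX : ∀ k ω, X (k + 1) ω = step (idx k ω) (X k ω))
    {V D : S → ℝ} (hV : ∀ s, 0 ≤ V s) (hD : ∀ s, 0 ≤ D s)
    (hVD : ∀ s, (n : ℝ)⁻¹ * ∑ i, V (step i s) ≤ V s - D s) :
    ∀ᵐ ω ∂μ, (∃ c, Tendsto (fun k => V (X k ω)) atTop (𝓝 c)) ∧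
      Summable fun k => D (X k ω) := by
  set Y : ℕ → Ω → ℝ := fun k ω => V (X k ω) + ∑ l ∈ Finset.range k, D (X l ω) with hY
  have hVi := fun k => integrable_comp_recursion (μ := μ) hmeas h0 hX k V
  have hDi := fun k => integrable_comp_recursion (μ := μ) hmeas h0 hX k D
  have hYi : ∀ k, Integrable (Y k) μ := fun k =>
    (hVi k).add (integrable_finsetSum _ fun l _ => hDi l)
  have hY0 : ∀ k ω, 0 ≤ Y k ω := fun k ω =>
    add_nonneg (hV _) (Finset.sum_nonneg fun l _ => hD _)
  have hadp : StronglyAdapted (pastFiltration hmeas) Y := fun k => by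
    refine Measurable.stronglyMeasurable ?_
    refine Measurable.add (measurable_comp_recursion h0 hX _ k
      (fun j hj => measurable_pastFiltration hmeas hj) V) ?_
    refine Finset.measurable_sum _ fun l hl => measurable_comp_recursion h0 hX _ l
      (fun j hj => measurable_pastFiltration hmeas (hj.trans (Finset.mem_range.1 hl))) D
  have hsup : Supermartingale Y (pastFiltration hmeas) μ := by
    refine supermartingale_of_setIntegral_succ_le hadp hYi fun k A hA => ?_
    have hSi : Integrable (fun ω => ∑ l ∈ Finset.range (k + 1), D (X l ω)) μ :=
      integrable_finsetSum _ fun l _ => hDi l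
    have hni : Integrable (fun ω => (n : ℝ)⁻¹ * ∑ i, V (step i (X k ω))) μ :=
      integrable_comp_recursion hmeas h0 hX k fun s => (n : ℝ)⁻¹ * ∑ i, V (step i s)
    simp only [hY]
    rw [integral_add (hVi (k + 1)).integrableOn hSi.integrableOn,
      setIntegral_comp_recursion_succ hmeas hindep hunif h0 hX k V hA,
      ← integral_add hni.integrableOn hSi.integrableOn]
    refine integral_mono (hni.add hSi).integrableOn (hYi k).integrableOn fun ω => ?_
    have := hVD (X k ω)
    simp only [Finset.sum_range_succ]
    linarith
  have hbdd : ∀ k, eLpNorm ((-Y) k) 1 μ ≤ ((∫ ω, Y 0 ω ∂μ).toNNReal : NNReal) := by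
    intro k
    rw [eLpNorm_one_eq_lintegral_enorm,
      ← ofReal_integral_norm_eq_lintegral_enorm (f := (-Y) k) (hYi k).neg]
    refine ENNReal.ofReal_le_ofReal ?_
    have h1 : ∫ ω, ‖(-Y) k ω‖ ∂μ = ∫ ω, Y k ω ∂μ := by
      refine integral_congr_ae (Eventually.of_forall fun ω => ?_)
      simp [abs_of_nonneg (hY0 k ω)]
    have h2 := hsup.setIntegral_le (Nat.zero_le k) MeasurableSet.univ
    rw [setIntegral_univ, setIntegral_univ] at h2
    exact h1.le.trans h2
  filter_upwards [hsup.neg.exists_ae_tendsto_of_bdd hbdd] with ω hω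
  obtain ⟨c, hc⟩ := hω
  have hc' : Tendsto (fun k => Y k ω) atTop (𝓝 (-c)) := by simpa using hc.neg
  obtain ⟨R, hR⟩ := hc'.bddAbove_range
  have hsumm : Summable fun k => D (X k ω) := by
    refine summable_of_sum_range_le (c := R) (fun k => hD _) fun k => ?_
    have := hR ⟨k, rfl⟩
    have h1 := hV (X k ω)
    simp only [hY] at this
    linarith
  refine ⟨⟨-c - ∑' k, D (X k ω), ?_⟩, hsumm⟩
  refine (hc'.sub hsumm.hasSum.tendsto_sum_nat).congr fun k => ?_
  simp [hY]

end RandomRecursion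

/-- If, for each functional `a ∈ A`, the sequence `q k - a (X k)` converges almost surely, then
almost surely it converges for all `a ∈ A` at once, although `A` may be uncountable: for a fixed
outcome the good functionals form an affine subspace, and `A` has a finite affine spanning set. -/
theorem ae_forall_tendsto_sub_apply {W Ω : Type*} [AddCommGroup W] [Module ℝ W]
    [FiniteDimensional ℝ W] [MeasurableSpace Ω] {μ : Measure Ω} {A : Set (Module.Dual ℝ W)}
    {q : ℕ → Ω → ℝ} {X : ℕ → Ω → W}
    (hA : ∀ a ∈ A, ∀ᵐ ω ∂μ, ∃ c, Tendsto (fun k => q k ω - a (X k ω)) atTop (𝓝 c)) :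
    ∀ᵐ ω ∂μ, ∀ a ∈ A, ∃ c, Tendsto (fun k => q k ω - a (X k ω)) atTop (𝓝 c) := by
  obtain ⟨T, hTA, hspan, hind⟩ := exists_affineIndependent ℝ (Module.Dual ℝ W) A
  have hfin : T.Finite := finite_set_of_fin_dim_affineIndependent ℝ hind
  have hall : ∀ᵐ ω ∂μ, ∀ a ∈ T, ∃ c, Tendsto (fun k => q k ω - a (X k ω)) atTop (𝓝 c) :=
    (ae_ball_iff hfin.countable).2 fun a ha => hA a (hTA ha)
  filter_upwards [hall] with ω hω a ha
  let C : AffineSubspace ℝ (Module.Dual ℝ W) :=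
    { carrier := {a | ∃ c, Tendsto (fun k => q k ω - a (X k ω)) atTop (𝓝 c)}
      smul_vsub_vadd_mem' := by
        rintro r a b d ⟨ca, ha⟩ ⟨cb, hb⟩ ⟨cd, hd⟩
        refine ⟨r * (ca - cb) + cd, (((ha.sub hb).const_mul r).add hd).congr fun k => ?_⟩
        simp only [vsub_eq_sub, vadd_eq_add, LinearMap.add_apply, LinearMap.smul_apply,
          LinearMap.sub_apply, smul_eq_mul]
        ring }
  have h1 : affineSpan ℝ T ≤ C := affineSpan_le.2 hω
  rw [hspan] at h1
  exact h1 (subset_affineSpan ℝ A ha)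

end CDPrimalDual

/-! ### Convergence to a saddle point -/

namespace CDPrimalDual

section Limit

variable {n p : ℕ} {E : Fin n → Type*} {F : Fin p → Type*}
  [∀ i, NormedAddCommGroup (E i)] [∀ i, InnerProductSpace ℝ (E i)]
  [∀ j, NormedAddCommGroup (F j)] [∀ j, InnerProductSpace ℝ (F j)]

theorem continuous_diag {l : ℕ} {A : Fin l → Type*} [∀ i, NormedAddCommGroup (A i)]
    [∀ i, InnerProductSpace ℝ (A i)] (γ : Fin l → ℝ) :
    Continuous (diag γ : PiLp 2 A → PiLp 2 A) := by
  unfold diag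
  fun_prop

variable [∀ i, FiniteDimensional ℝ (E i)]

theorem continuous_block (M : PiLp 2 E →ₗ[ℝ] PiLp 2 F) (j : Fin p) (i : Fin n) :
    Continuous (block M j i) :=
  LinearMap.continuous_of_finiteDimensional _

theorem continuous_form_self (M : PiLp 2 E →ₗ[ℝ] PiLp 2 F) (τ : Fin n → ℝ) (σ : Fin p → ℝ) :
    Continuous fun s : Pair M => form M τ σ s s := by
  simp only [form_apply, blockForm_apply]
  have hb := continuous_block M
  have h1 : ∀ (j : Fin p) (i : Fin n), Continuous fun s : Pair M => block M j i (s.1 i) :=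
    fun j i => (hb j i).comp (by fun_prop)
  fun_prop

section Lyapunov

variable {f : PiLp 2 E → ℝ} {M : PiLp 2 E →ₗ[ℝ] PiLp 2 F} {τ : Fin n → ℝ} {σ : Fin p → ℝ}

theorem half_mul_norm_sq_le_lyapunov (hf : ConvexOn ℝ Set.univ f) (hf' : Differentiable ℝ f)
    {β : Fin n → ℝ} (hβ : ∀ i, 0 ≤ β i) {c : ℝ}
    (hc : ∀ s : Pair M, c * ‖s‖ ^ 2 ≤ form M τ σ s s - ∑ i, β i * ‖s.1 i‖ ^ 2) (t s : Pair M) :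
    c / 2 * ‖s - t‖ ^ 2 ≤ lyapunov f M τ σ t s := by
  have h1 := hc (s - t)
  have h2 := add_inner_grad_le hf hf' t.1 s.1
  have h3 : 0 ≤ ∑ i, β i * ‖(s - t).1 i‖ ^ 2 :=
    Finset.sum_nonneg fun i _ => mul_nonneg (hβ i) (sq_nonneg _)
  simp only [lyapunov]
  linarith

variable (f M τ σ) in
/-- The linear part of the Lyapunov function with reference point `t`. -/
noncomputable def lyapunovLinear (t : Pair M) : Module.Dual ℝ (Pair M) :=
  form M τ σ t + innerₗ (PiLp 2 E) (grad f t.1) ∘ₗ LinearMap.fst ℝ _ _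

/-- The reference point enters the Lyapunov function only through an affine function. -/
theorem lyapunov_eq (t s : Pair M) :
    lyapunov f M τ σ t s = (1 / 2 * form M τ σ s s + f s.1) - lyapunovLinear f M τ σ t s +
      (1 / 2 * form M τ σ t t - f t.1 + inner ℝ (grad f t.1) t.1) := by
  simp only [lyapunov, lyapunovLinear, LinearMap.add_apply, LinearMap.comp_apply,
    LinearMap.fst_apply, innerₗ_apply_apply, map_sub, LinearMap.sub_apply, inner_sub_right]
  rw [form_comm s t]
  ring

end Lyapunov

variable [∀ j, FiniteDimensional ℝ (F j)]

theorem continuous_pairState_z (M : PiLp 2 E →ₗ[ℝ] PiLp 2 F) :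
    Continuous fun s : Pair M => (pairState s).z := by
  simp only [pairState, initState]
  fun_prop

theorem continuous_pairState_w (M : PiLp 2 E →ₗ[ℝ] PiLp 2 F) :
    Continuous fun s : Pair M => (pairState s).w := by
  simp only [pairState, initState]
  have h1 : ∀ (i : Fin n) (j : J M i), Continuous fun s : Pair M =>
      (block M j i).adjoint (s.2 j ⟨i, mem_I_of_mem_J j.2⟩) := fun i j =>
    (LinearMap.continuous_of_finiteDimensional _).comp (by fun_prop)
  fun_prop

theorem pairState_z_dup {M : PiLp 2 E →ₗ[ℝ] PiLp 2 F} (hm : ∀ j, m M j ≠ 0) (x : PiLp 2 E)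
    (y : PiLp 2 F) : (pairState (x, dup M y)).z = y := by
  have h1 := initState_z_sub_dup hm x x (dup M y) y
  have h2 : (initState M x (dup M y - dup M y)).z = 0 := by
    ext j; simp [initState]
  rw [h2] at h1
  exact (sub_eq_zero.1 h1.symm)

theorem inner_pairState_w_dup (M : PiLp 2 E →ₗ[ℝ] PiLp 2 F) (x v : PiLp 2 E) (y : PiLp 2 F) :
    inner ℝ (pairState (x, dup M y)).w v = inner ℝ y (M v) := by
  have h1 := inner_pairState_w_sub_dup x x v (dup M y) y
  rw [inner_initState_w] at h1
  simp only [sub_self, Pi.zero_apply, inner_zero_left, Finset.sum_const_zero] at h1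
  exact sub_eq_zero.1 h1.symm

variable {f : PiLp 2 E → ℝ} {g : PiLp 2 E → EReal} {h : PiLp 2 F → EReal}
  {M : PiLp 2 E →ₗ[ℝ] PiLp 2 F} {τ : Fin n → ℝ} {σ : Fin p → ℝ}

/-- A limit of points whose full updates get asymptotically close to them is a saddle point with
all dual copies equal. One passes to the limit in the variational inequalities of the proximal
steps, by lower semicontinuity; the term `⟪∇f(x), x - x̄⟫` is bounded by `f (2 x - x̄) - f x`, so that
no continuity of the gradient is used. -/
theorem exists_saddle_of_tendsto (hm : ∀ j, m M j ≠ 0) (hf : ConvexOn ℝ Set.univ f)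
    (hf' : Differentiable ℝ f) (hg : IsClosedProperConvex g) (hh : IsClosedProperConvex h)
    (hσ : ∀ j, 0 < σ j) (hτ : ∀ i, 0 < τ i) {s : ℕ → Pair M} {t : Pair M}
    (hs : Tendsto s atTop (𝓝 t))
    (hd : Tendsto (fun k => s k - fullUpdate f g h τ σ (s k)) atTop (𝓝 0)) :
    ∃ (xs : PiLp 2 E) (ys : PiLp 2 F),
      (xs, ys) ∈ saddlePoints f g h M ∧ t = (xs, dup M ys) := by
  set x : ℕ → PiLp 2 E := fun k => (s k).1 with hx
  set xb : ℕ → PiLp 2 E := fun k => xBar f g h M τ σ (pairState (s k)) with hxb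
  set yb : ℕ → PiLp 2 F := fun k => yBar h M σ (pairState (s k)) with hyb
  have hu : Tendsto (fun k => fullUpdate f g h τ σ (s k)) atTop (𝓝 t) := by
    simpa using hs.sub hd
  have hxl : Tendsto x atTop (𝓝 t.1) := hs.fst_nhds
  have hxbl : Tendsto xb atTop (𝓝 t.1) := hu.fst_nhds
  have hybl : ∀ (j : Fin p) (i : I M j), Tendsto (fun k => yb k j) atTop (𝓝 (t.2 j i)) :=
    fun j i => tendsto_pi_nhds.1 (tendsto_pi_nhds.1 hu.snd_nhds j) i
  have hI : ∀ j, (I M j).Nonempty := fun j => Finset.card_ne_zero.1 (hm j)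
  choose i₀ hi₀ using hI
  set ys : PiLp 2 F := WithLp.toLp 2 fun j => t.2 j ⟨i₀ j, hi₀ j⟩ with hys
  have hyl : Tendsto yb atTop (𝓝 ys) := by
    have h1 : Tendsto (fun k => WithLp.ofLp (yb k)) atTop (𝓝 (WithLp.ofLp ys)) :=
      tendsto_pi_nhds.2 fun j => hybl j ⟨i₀ j, hi₀ j⟩
    exact (PiLp.continuous_toLp 2 F).continuousAt.tendsto.comp h1
  have ht : t = (t.1, dup M ys) := by
    refine Prod.ext rfl ?_
    funext j i
    exact tendsto_nhds_unique (hybl j i) (hybl j ⟨i₀ j, hi₀ j⟩)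
  have hMc : Continuous M := LinearMap.continuous_of_finiteDimensional M
  have hzl : Tendsto (fun k => (pairState (s k)).z) atTop (𝓝 ys) := by
    have h1 := ((continuous_pairState_z M).tendsto t).comp hs
    rw [ht, pairState_z_dup hm] at h1
    exact h1
  have hwl : Tendsto (fun k => (pairState (s k)).w) atTop (𝓝 (pairState t).w) :=
    ((continuous_pairState_w M).tendsto t).comp hs
  have hw : ∀ v, inner ℝ (pairState t).w v = inner ℝ ys (M v) := fun v => by
    rw [ht, inner_pairState_w_dup]
  have hprimal : ∀ (v : PiLp 2 E) (r : ℝ), g v ≤ r →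
      g t.1 ≤ ((r + f v - f t.1 + inner ℝ ys (M (v - t.1)) : ℝ) : EReal) := by
    intro v r hr
    set R : ℕ → ℝ := fun k => r - inner ℝ (diag (fun i => (τ i)⁻¹) (x k - xb k)) (v - xb k) +
      2 * inner ℝ (yb k) (M (v - xb k)) - inner ℝ (pairState (s k)).w (v - xb k) +
      (f v - f (x k) + (f (x k + (x k - xb k)) - f (x k))) with hR
    have hle : ∀ k, g (xb k) ≤ R k := by
      intro k
      obtain ⟨a, ha, hak⟩ := exists_xBar_le (f := f) (h := h) (σ := σ) hg hτ (pairState (s k))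
      have h1 := hak v r hr
      rw [ha, EReal.coe_le_coe_iff]
      have h2 := add_inner_grad_le hf hf' (x k) v
      have h3 := add_inner_grad_le hf hf' (x k) (x k + (x k - xb k))
      rw [add_sub_cancel_left] at h3
      have h4 : inner ℝ (grad f (x k)) (v - xb k) =
          inner ℝ (grad f (x k)) (v - x k) + inner ℝ (grad f (x k)) (x k - xb k) := by
        rw [← inner_add_right]; congr 1; abel
      change a + (inner ℝ (diag (fun i => (τ i)⁻¹) (x k - xb k)) (v - xb k) -
        inner ℝ (grad f (x k)) (v - xb k) - 2 * inner ℝ (yb k) (M (v - xb k)) +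
        inner ℝ (pairState (s k)).w (v - xb k)) ≤ r at h1
      simp only [hR]
      linarith
    have hRl : Tendsto R atTop (𝓝 (r - inner ℝ (diag (fun i => (τ i)⁻¹) (t.1 - t.1)) (v - t.1) +
        2 * inner ℝ ys (M (v - t.1)) - inner ℝ (pairState t).w (v - t.1) +
        (f v - f t.1 + (f (t.1 + (t.1 - t.1)) - f t.1)))) := by
      have hfx : Tendsto (fun k => f (x k)) atTop (𝓝 (f t.1)) :=
        (hf'.continuous.tendsto _).comp hxl
      have hv : Tendsto (fun k => v - xb k) atTop (𝓝 (v - t.1)) := hxbl.const_sub v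
      refine Tendsto.add (Tendsto.sub (Tendsto.add (Tendsto.const_sub _ ?_)
        (Tendsto.const_mul 2 ?_)) (hwl.inner hv)) (Tendsto.add (hfx.const_sub _)
        (Tendsto.sub ?_ hfx))
      · exact Tendsto.inner (((continuous_diag _).tendsto _).comp (hxl.sub hxbl)) hv
      · exact hyl.inner ((hMc.tendsto _).comp hv)
      · exact (hf'.continuous.tendsto _).comp (hxl.add (hxl.sub hxbl))
    have h1 := hg.le_of_tendsto hxbl hRl hle
    have h0 : diag (fun i => (τ i)⁻¹) (0 : PiLp 2 E) = 0 := by ext i; simp [diag_apply]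
    rw [hw, sub_self, h0, inner_zero_left, add_zero] at h1
    refine h1.trans (EReal.coe_le_coe_iff.2 (le_of_eq ?_))
    ring
  have hdual : ∀ (z : PiLp 2 F) (r : ℝ), conj h z ≤ r →
      conj h ys ≤ ((r - inner ℝ (z - ys) (M t.1) : ℝ) : EReal) := by
    intro z r hr
    set R : ℕ → ℝ := fun k => r - (inner ℝ (diag (fun j => (σ j)⁻¹) ((pairState (s k)).z - yb k))
      (z - yb k) + inner ℝ (z - yb k) (M (x k))) with hR
    have hle : ∀ k, conj h (yb k) ≤ R k := by
      intro k
      obtain ⟨b, hb, hbk⟩ := exists_yBar_le (M := M) hh hσ (pairState (s k))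
      have h1 := hbk z r hr
      rw [hb, EReal.coe_le_coe_iff]
      change b + (inner ℝ (diag (fun j => (σ j)⁻¹) ((pairState (s k)).z - yb k)) (z - yb k) +
        inner ℝ (z - yb k) (M (x k))) ≤ r at h1
      simp only [hR]
      linarith
    have hRl : Tendsto R atTop (𝓝 (r - (inner ℝ (diag (fun j => (σ j)⁻¹) (ys - ys)) (z - ys) +
        inner ℝ (z - ys) (M t.1)))) := by
      have hz : Tendsto (fun k => z - yb k) atTop (𝓝 (z - ys)) := hyl.const_sub z
      refine Tendsto.const_sub _ (Tendsto.add ?_ ?_)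
      · exact Tendsto.inner (((continuous_diag _).tendsto _).comp (hzl.sub hyl)) hz
      · exact hz.inner ((hMc.tendsto _).comp hxl)
    have h1 := hh.conj.le_of_tendsto hyl hRl hle
    have h0 : diag (fun j => (σ j)⁻¹) (0 : PiLp 2 F) = 0 := by ext j; simp [diag_apply]
    rwa [sub_self, h0, inner_zero_left, zero_add] at h1
  refine ⟨t.1, ys, (mem_saddlePoints_iff hg hh).2 ?_, ht⟩
  obtain ⟨v₀, r₀, hv₀⟩ := hg.exists_real
  obtain ⟨z₀, q₀, hz₀⟩ := hh.conj.exists_real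
  obtain ⟨a, ha, -⟩ := hg.exists_real_le (hprimal v₀ r₀ hv₀.le)
  obtain ⟨b, hb, -⟩ := hh.conj.exists_real_le (hdual z₀ q₀ hz₀.le)
  refine ⟨a, b, ha, hb, fun v r hr => ?_, fun z r hr => ?_⟩
  · have h1 := hprimal v r hr
    rw [ha, EReal.coe_le_coe_iff, map_sub, inner_sub_right] at h1
    linarith
  · have h1 := hdual z r hr
    rw [hb, EReal.coe_le_coe_iff, real_inner_comm] at h1
    linarith

/-- Opial's argument: if the full updates get asymptotically close to the iterates and all the
Lyapunov functions attached to saddle points converge along the iterates, then the iterates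
converge to a saddle point. -/
theorem exists_tendsto_saddle (hm : ∀ j, m M j ≠ 0) (hf : ConvexOn ℝ Set.univ f)
    (hf' : Differentiable ℝ f) (hg : IsClosedProperConvex g) (hh : IsClosedProperConvex h)
    (hσ : ∀ j, 0 < σ j) (hτ : ∀ i, 0 < τ i) {β : Fin n → ℝ} (hβ : ∀ i, 0 ≤ β i)
    (hstep : ∀ i, τ i * (β i + stepRadius M σ i) < 1)
    (hS : (saddlePoints f g h M).Nonempty) {s : ℕ → Pair M}
    (hd : Tendsto (fun k => s k - fullUpdate f g h τ σ (s k)) atTop (𝓝 0))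
    (hconv : ∀ xs ys, (xs, ys) ∈ saddlePoints f g h M →
      ∃ c, Tendsto (fun k => lyapunov f M τ σ (xs, dup M ys) (s k)) atTop (𝓝 c)) :
    ∃ (xs : PiLp 2 E) (ys : PiLp 2 F), (xs, ys) ∈ saddlePoints f g h M ∧
      Tendsto s atTop (𝓝 (xs, dup M ys)) := by
  obtain ⟨c, hc0, hc⟩ := exists_norm_sq_le_form (M := M) hm hσ hτ hstep
  have hlow := half_mul_norm_sq_le_lyapunov (τ := τ) (σ := σ) hf hf' hβ hc
  obtain ⟨⟨x₀, y₀⟩, h₀⟩ := hS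
  obtain ⟨R, hR⟩ := (hconv x₀ y₀ h₀).choose_spec.bddAbove_range
  have hbdd : ∀ k, s k ∈ Metric.closedBall (x₀, dup M y₀) √(R / (c / 2)) := by
    intro k
    rw [Metric.mem_closedBall, dist_eq_norm]
    refine Real.le_sqrt_of_sq_le ((le_div_iff₀' (by positivity)).2 ?_)
    exact (hlow _ _).trans (hR ⟨k, rfl⟩)
  have : ProperSpace (Pair M) := FiniteDimensional.proper_real _
  obtain ⟨t, -, φ, hφ, hlim⟩ := tendsto_subseq_of_bounded Metric.isBounded_closedBall hbdd
  obtain ⟨xs, ys, hmem, rfl⟩ := exists_saddle_of_tendsto hm hf hf' hg hh hσ hτ hlim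
    (hd.comp hφ.tendsto_atTop)
  refine ⟨xs, ys, hmem, ?_⟩
  obtain ⟨d, hdl⟩ := hconv xs ys hmem
  have hcont : Continuous (lyapunov f M τ σ (xs, dup M ys)) := by
    have h1 := continuous_form_self M τ σ
    have h2 := hf'.continuous
    have h3 : Continuous fun s : Pair M => form M τ σ (s - (xs, dup M ys)) (s - (xs, dup M ys)) :=
      h1.comp (continuous_id.sub continuous_const)
    unfold lyapunov
    fun_prop
  have hsub := (hcont.tendsto (xs, dup M ys)).comp hlim
  have hzero : lyapunov f M τ σ (xs, dup M ys) (xs, dup M ys) = 0 := by simp [lyapunov]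
  rw [hzero] at hsub
  have hd0 : d = 0 := tendsto_nhds_unique (hdl.comp hφ.tendsto_atTop) hsub
  rw [hd0] at hdl
  have hsq : Tendsto (fun k => ‖s k - (xs, dup M ys)‖ ^ 2) atTop (𝓝 0) := by
    have h1 : Tendsto (fun k => (c / 2)⁻¹ * lyapunov f M τ σ (xs, dup M ys) (s k)) atTop (𝓝 0) := by
      simpa using hdl.const_mul (c / 2)⁻¹
    refine squeeze_zero (fun k => sq_nonneg _) (fun k => ?_) h1
    rw [le_inv_mul_iff₀ (by positivity)]
    exact hlow _ _
  rw [tendsto_iff_norm_sub_tendsto_zero]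
  simpa using hsq.sqrt

end Limit

end CDPrimalDual

theorem theorem1 {n p : ℕ} {E : Fin n → Type*} {F : Fin p → Type*}
    [∀ i, NormedAddCommGroup (E i)] [∀ i, InnerProductSpace ℝ (E i)]
    [∀ i, FiniteDimensional ℝ (E i)]
    [∀ j, NormedAddCommGroup (F j)] [∀ j, InnerProductSpace ℝ (F j)]
    [∀ j, FiniteDimensional ℝ (F j)]
    (f : PiLp 2 E → ℝ) (g : PiLp 2 E → EReal) (h : PiLp 2 F → EReal)
    (M : PiLp 2 E →ₗ[ℝ] PiLp 2 F)
    (hm : ∀ j, CDPrimalDual.m M j ≠ 0)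
    (hf : ConvexOn ℝ Set.univ f) (hf' : Differentiable ℝ f)
    (hg : CDPrimalDual.IsClosedProperConvex g) (hh : CDPrimalDual.IsClosedProperConvex h)
    (β : Fin n → ℝ) (hβ : ∀ i, 0 ≤ β i)
    (hsmooth : ∀ (i : Fin n) (x : PiLp 2 E) (u : E i),
      f (x + PiLp.single 2 i u) ≤
        f x + inner ℝ (CDPrimalDual.grad f x) (PiLp.single 2 i u) + β i / 2 * ‖u‖ ^ 2)
    (σ : Fin p → ℝ) (hσ : ∀ j, 0 < σ j)
    (τ : Fin n → ℝ) (hτ : ∀ i, 0 < τ i)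
    -- `τ i < 1 / (β i + ρ)`, read as no condition when `β i + ρ = 0`
    (hstep : ∀ i, τ i * (β i + CDPrimalDual.stepRadius M σ i) < 1)
    (hS : (CDPrimalDual.saddlePoints f g h M).Nonempty)
    {Ω : Type*} [MeasurableSpace Ω] (μ : Measure Ω) [IsProbabilityMeasure μ]
    -- `idx k` is the coordinate selected to pass from iterate `k` to iterate `k + 1`
    (idx : ℕ → Ω → Fin n) (hmeas : ∀ k, Measurable (idx k)) (hindep : iIndepFun idx μ)
    (hunif : ∀ k i, μ {ω | idx k ω = i} = (n : ENNReal)⁻¹)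
    (x₀ : PiLp 2 E) (yy₀ : (j : Fin p) → CDPrimalDual.I M j → F j) :
    ∀ᵐ ω ∂μ, ∃ (xs : PiLp 2 E) (ys : PiLp 2 F),
      (xs, ys) ∈ CDPrimalDual.saddlePoints f g h M ∧
      Tendsto
        (fun k => (CDPrimalDual.iterates f g h M τ σ x₀ yy₀ (fun l => idx l ω) k).x)
        atTop (𝓝 xs) ∧
      ∀ (j : Fin p) (i : CDPrimalDual.I M j),
        Tendsto
          (fun k => (CDPrimalDual.iterates f g h M τ σ x₀ yy₀ (fun l => idx l ω) k).yy j i)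
          atTop (𝓝 (ys j)) := by
  open CDPrimalDual in
  obtain ⟨ω₀⟩ : Nonempty Ω := nonempty_of_isProbabilityMeasure μ
  have hn : (0 : ℝ) < n := Nat.cast_pos.2 (Fin.pos (idx 0 ω₀))
  obtain ⟨c, hc0, hc⟩ := exists_norm_sq_le_form (M := M) hm hσ hτ hstep
  set X : ℕ → Ω → Pair M := fun k ω => trajectory f g h τ σ (x₀, yy₀) (fun l => idx l ω) k with hX
  set D : Pair M → ℝ := fun s => (n : ℝ)⁻¹ * (c / 2 * ‖s - fullUpdate f g h τ σ s‖ ^ 2) with hD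
  have hD0 : ∀ s, 0 ≤ D s := fun s => by positivity
  have hdescent : ∀ xs ys, (xs, ys) ∈ saddlePoints f g h M →
      ∀ᵐ ω ∂μ, (∃ c, Tendsto (fun k => lyapunov f M τ σ (xs, dup M ys) (X k ω)) atTop (𝓝 c)) ∧
        Summable fun k => D (X k ω) := by
    intro xs ys hmem
    refine ae_tendsto_and_summable_of_sum_le (step := coordUpdate f g h τ σ) hmeas hindep hunif
      (fun ω => rfl) (fun k ω => rfl) (fun s => ?_) hD0 fun s => ?_
    · exact le_trans (by positivity) (half_mul_norm_sq_le_lyapunov hf hf' hβ hc _ s)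
    · have h1 := sum_lyapunov_coordUpdate_le hm hf hf' hg hh hσ hτ hsmooth hmem s
      have h2 := hc (s - fullUpdate f g h τ σ s)
      rw [inv_mul_le_iff₀ hn, mul_sub, hD, mul_inv_cancel_left₀ hn.ne']
      linarith
  have hall : ∀ᵐ ω ∂μ, ∀ a ∈ {a | ∃ xs ys, (xs, ys) ∈ saddlePoints f g h M ∧
      a = lyapunovLinear f M τ σ (xs, dup M ys)}, ∃ c, Tendsto (fun k =>
        (1 / 2 * form M τ σ (X k ω) (X k ω) + f (X k ω).1) - a (X k ω)) atTop (𝓝 c) := by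
    refine ae_forall_tendsto_sub_apply
      (q := fun k ω => 1 / 2 * form M τ σ (X k ω) (X k ω) + f (X k ω).1) ?_
    rintro _ ⟨xs, ys, hmem, rfl⟩
    filter_upwards [hdescent xs ys hmem] with ω hω
    obtain ⟨⟨d, hd⟩, -⟩ := hω
    refine ⟨_, (hd.sub_const (1 / 2 * form M τ σ (xs, dup M ys) (xs, dup M ys) - f xs +
      inner ℝ (grad f xs) xs)).congr fun k => ?_⟩
    rw [lyapunov_eq]
    ring
  obtain ⟨⟨x₁, y₁⟩, h₁⟩ := id hS
  filter_upwards [hall, hdescent x₁ y₁ h₁] with ω hω hω₁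
  have hd : Tendsto (fun k => X k ω - fullUpdate f g h τ σ (X k ω)) atTop (𝓝 0) := by
    have h1 := hω₁.2.tendsto_atTop_zero.const_mul ((n : ℝ) * (c / 2)⁻¹)
    have h2 : Tendsto (fun k => ‖X k ω - fullUpdate f g h τ σ (X k ω)‖ ^ 2) atTop (𝓝 0) := by
      rw [mul_zero] at h1
      refine h1.congr fun k => ?_
      simp only [hD]
      field_simp
    rw [tendsto_zero_iff_norm_tendsto_zero]
    simpa using h2.sqrt
  obtain ⟨xs, ys, hmem, hlim⟩ := exists_tendsto_saddle hm hf hf' hg hh hσ hτ hβ hstep hS hd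
    fun xs ys hmem => by
      obtain ⟨d, hd⟩ := hω _ ⟨xs, ys, hmem, rfl⟩
      refine ⟨_, (hd.add_const (1 / 2 * form M τ σ (xs, dup M ys) (xs, dup M ys) - f xs +
        inner ℝ (grad f xs) xs)).congr fun k => ?_⟩
      rw [lyapunov_eq]
  refine ⟨xs, ys, hmem, ?_, fun j i => ?_⟩
  · refine hlim.fst_nhds.congr fun k => ?_
    rw [iterates_eq]
    rfl
  · refine (tendsto_pi_nhds.1 (tendsto_pi_nhds.1 hlim.snd_nhds j) i).congr fun k => ?_
    rw [iterates_eq]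
    rfl
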